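/- **Setting.** Let $S$ be a locally compact Hausdorff space with countable basis and $\lambda$ a Radon measure on $S$ with $\lambda(O)>0$ for every non-empty open set $O$. Write $\mathbb N=\{1,2,\dots\}$. A configuration over $S$ is a countable sum $\mathsf s=\sum_i\delta_{s_i}$, $s_i\in S$, with $\mathsf s(C)<\infty$ for compact $C$; the configuration space $\mathsf S$ carries the $\sigma$-field generated by the maps $\mathsf s\mapsto \mathsf s(A)$, $A$ Borel. For a real $\alpha$ and an $m\times m$ matrix put $\det_\alpha (a_{p,q})=\sum_{\sigma\in\mathfrak S_m}\alpha^{m-\nu(\sigma)}\prod_{p=1}^m a_{p,\sigma(p)}$, where $\nu(\sigma)$ is the number of cycles of $\sigma$ (fixed points included). A non-negative symmetric Borel function $\rho^m$ on $S^m$ is the $m$-point correlation function with respect to $\lambda$ of a probability measure $\mu$ on $\mathsf S$ if $$\int_{\mathsf S}\prod_{i=1}^{j}\frac{\mathsf s(A_i)!}{(\mathsf s(A_i)-k_i)!}\,\mu(d\mathsf s)=\int_{A_1^{k_1}\times\cdots\times A_j^{k_j}}\rho^m\,d\lambda^m\qquad(\ast)$$ for all disjoint Borel sets $A_1,\dots,A_j$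 and $k_1+\dots+k_j=m$; a factor on the left is read as $0$ if $\mathsf s(A_i)<k_i$. The measure $\mu$ is an $\alpha$-determinantal point process associated with $(\mathsf K,\lambda)$ if, for every $m$, it has the $m$-point correlation function $\det_\alpha[\mathsf K(x_p,x_q)]_{p,q=1}^m$ (up to $\lambda^m$-null sets). The same notions are used on a countable discrete set in place of $S$, with counting measure. **Assumptions on the kernel.** $\alpha\in\{2/q:q\in\mathbb N\}\cup\{-1/q:q\in\mathbb N\}$. The kernel $\mathsf K:S\times S\to\mathbb C$ is measurable and Hermitian symmetric, it defines a bounded operator $\mathsf K f(x)=\int\mathsf K(x,y)f(y)\lambda(dy)$ on $L^2(S,\lambda)$ with spectrum in $[0,\infty)$, and in $[0,-1/\alpha]$ if $\alpha<0$, and for compact $A$ the operator $\mathsf K_A$ with kernel $1_A(x)\mathsf K(x,y)1_A(y)$ is of trace class. The version of the kernel is, as usual, one that computes traces: for every relatively compact Borel set $A$, $\mathsf K(x,x)$ is integrable on $A$ and $\operatorname{Tr}\mathsf K_A=\int_A\mathsf K(x,x)\,\lambda(dx)$. Let $\mu$ be an $\alpha$-determinantal point process associated with $(\mathsf K,\lambda)$.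 **Partitions.** Let $I$ be countable, $I(\ell)=I\times\{0,1\}^{\ell-1}$ for $\ell\in\mathbb N$, and let $\Delta(\ell)=\{\mathcal A_{\ell,i}\}_{i\in I(\ell)}$ be partitions of $S$ into relatively compact Borel sets of positive $\lambda$-measure such that $\mathcal A_{\ell+1,i}\subset\mathcal A_{\ell,i^-}$ for $i\in I(\ell+1)$, where $i^-$ is $i$ without its last entry. Put $\mathcal F_\ell=\sigma[\mathcal A_{\ell,i};i\in I(\ell)]$ and assume that $\bigcup_\ell\mathcal F_\ell$ generates the Borel $\sigma$-field of $S$. Let $\mathcal G_\ell=\sigma[\{\mathsf s:\mathsf s(\mathcal A_{\ell,i})=n\};i\in I(\ell),n\ge0]$. The $m$-point correlation function $\rho_\ell^m$ of $\mu|_{\mathcal G_\ell}$ (with respect to $\lambda$) is a non-negative symmetric function on $S^m$, measurable with respect to the $m$-fold product $\sigma$-field of $\mathcal F_\ell$, that satisfies $(\ast)$ for all disjoint $A_1,\dots,A_j\in\mathcal F_\ell$. **Trees and bases.** Let $\mathbb I$ be the set of all $i\in\bigcup_{r\ge1}I(r)$ that lie in $I(1)$ or have last entry $0$; $i\in I(r)$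 has rank $r$. Put $\mathcal B_i=\mathcal A_{1,i}$ if $i$ has rank $1$ and $\mathcal B_i=\mathcal A_{r-1,i^-}$ if $i$ has rank $r\ge2$. Let $\{f_i\}_{i\in\mathbb I}$ be real functions on $S$ that form an orthonormal basis of $L^2(S,\lambda)$ with $\{f_i\ne0\}=\mathcal B_i$ for all $i$, $\sigma[f_i;\operatorname{rank}(i)=r]=\mathcal F_r$ for all $r$, and $f_i=1_{\mathcal A_{1,i}}/\sqrt{\lambda(\mathcal A_{1,i})}$ for $i$ of rank $1$. For $\ell\in\mathbb N$ let $\mathbb I(\ell)$ be the set of all $i=(\mathbf j,j_{\ell+1},\dots,j_{\ell+r-1})\in I(\ell)\times\{0,1\}^{r-1}$, $r\ge1$, such that $r=1$ or $j_{\ell+r-1}=0$. If $r=1$, put $f_{\ell,i}=1_{\mathcal A_{\ell,i}}/\sqrt{\lambda(\mathcal A_{\ell,i})}$ and $\mathcal B_{\ell,i}=\mathcal A_{\ell,i}$; if $r\ge2$, put $f_{\ell,i}=f_j$ and $\mathcal B_{\ell,i}=\mathcal B_j$, where $j\in\mathbb I$ is $i$ read as an element of $I(\ell+r-1)$. Let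 $$\mathsf K_{\mathbb F(\ell)}(i,j)=\int_{S\times S}\mathsf K(x,y)f_{\ell,i}(x)f_{\ell,j}(y)\,\lambda(dx)\lambda(dy),\qquad i,j\in\mathbb I(\ell),$$ let $\nu_{\mathbb F(\ell)}$ be an $\alpha$-determinantal point process on $\mathbb I(\ell)$ associated with $\mathsf K_{\mathbb F(\ell)}$ and the counting measure, and let $\rho^m_{\mathbb F(\ell)}$ be its $m$-point correlation function with respect to the counting measure. **Theorem 2.1.** Let $\ell,m\in\mathbb N$, let $\mathcal A_1,\dots,\mathcal A_m\in\Delta(\ell)$ (repetitions allowed), $\mathbb A=\mathcal A_1\times\cdots\times\mathcal A_m$, and $\mathbb I_\ell(\mathbb A)=\mathbb I_\ell(\mathcal A_1)\times\cdots\times\mathbb I_\ell(\mathcal A_m)$, where $\mathbb I_\ell(\mathcal A)=\{i\in\mathbb I(\ell):\mathcal B_{\ell,i}\subset\mathcal A\}$. Then $$\int_{\mathbb A}\rho_\ell^m(\mathbf x)\,\lambda^m(d\mathbf x)=\sum_{\mathbf i\in\mathbb I_\ell(\mathbb A)}\rho_{\mathbb F(\ell)}^m(\mathbf i),$$ and both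 sides are finite. -/

import Mathlib

open MeasureTheory Set
open scoped ENNReal NNReal InnerProductSpace

noncomputable section

namespace TreeRep

/-! ### Configurations and correlation functions -/

/-- The configuration space over `S`: all countable sums of Dirac masses that are finite on
compact sets.  Its measurable structure (inherited from `Measure S`) is generated by the
evaluations `s ↦ s A` at Borel sets `A`; this is the Borel σ-field of the vague topology when
`S` is locally compact, Hausdorff and second countable. -/
def Conf (S : Type*) [TopologicalSpace S] [MeasurableSpace S] : Type _ :=
  {s : Measure S //
    (∃ (N : Set ℕ) (x : N → S), s = Measure.sum fun i => Measure.dirac (x i)) ∧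
      ∀ C : Set S, IsCompact C → s C < ∞}

instance (S : Type*) [TopologicalSpace S] [MeasurableSpace S] : MeasurableSpace (Conf S) :=
  inferInstanceAs (MeasurableSpace {s : Measure S //
    (∃ (N : Set ℕ) (x : N → S), s = Measure.sum fun i => Measure.dirac (x i)) ∧
      ∀ C : Set S, IsCompact C → s C < ∞})

/-- The number of points `s(A)` of the configuration `s` in `A`. -/
def Conf.count {S : Type*} [TopologicalSpace S] [MeasurableSpace S] (s : Conf S) (A : Set S) :
    ℝ≥0∞ :=
  s.1 A

theorem Conf.measurable_count {S : Type*} [TopologicalSpace S] [MeasurableSpace S] {A : Set S}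
    (hA : MeasurableSet A) : Measurable fun s : Conf S => s.count A :=
  (Measure.measurable_coe hA).comp measurable_subtype_coe

/-- The falling factorial `a (a - 1) ⋯ (a - k + 1)`, that is `a! / (a - k)!`.
It is `0` for a natural number `a < k`, and `∞` for `a = ∞` and `k ≥ 1`. -/
def fallingFactorial (a : ℝ≥0∞) (k : ℕ) : ℝ≥0∞ :=
  ∏ t ∈ Finset.range k, (a - t)

/-- The identity `∫ ∏ i, s(A i)! / (s(A i) - k i)! μ(ds) = ∫_{A 1 ^ k 1 × ⋯ × A j ^ k j} ρ dlam^m`.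
The map `c` says in which of the sets `A i` each of the `m` coordinates has to lie, so `A i` occurs
`k i = #{p | c p = i}` times in the box; for a symmetric `ρ` the order does not matter.
The law `μ` may live on any σ-field `G` of the configuration space. -/
def MomentIdentity {S : Type*} [TopologicalSpace S] [MeasurableSpace S]
    {G : MeasurableSpace (Conf S)} (μ : @Measure (Conf S) G) (lam : Measure S) {m : ℕ}
    (ρ : (Fin m → S) → ℝ≥0) {j : ℕ} (A : Fin j → Set S) (c : Fin m → Fin j) : Prop :=
  ∫⁻ s, ∏ i, fallingFactorial (s.count (A i)) (Finset.univ.filter fun p => c p = i).card ∂μ =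
    ∫⁻ x in {x : Fin m → S | ∀ p, x p ∈ A (c p)}, (ρ x : ℝ≥0∞) ∂(Measure.pi fun _ => lam)

/-- `ρ` is an `m`-point correlation function, with respect to `lam`, of the law `μ` (a measure on
some σ-field `G` of the configuration space), tested on disjoint sets of the σ-field `F` on `S`
and measurable with respect to the `m`-fold product of `F`.
For `F` the Borel σ-field of `S` and `G` that of the configuration space this is the usual
notion. -/
structure IsCorrelationFunction {S : Type*} [TopologicalSpace S] [M : MeasurableSpace S]
    {G : MeasurableSpace (Conf S)} (μ : @Measure (Conf S) G) (lam : Measure S)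
    (F : MeasurableSpace S) (m : ℕ) (ρ : (Fin m → S) → ℝ≥0) : Prop where
  measurable : @Measurable _ _ (@MeasurableSpace.pi (Fin m) (fun _ => S) fun _ => F) _ ρ
  symmetric : ∀ (σ : Equiv.Perm (Fin m)) (x : Fin m → S), ρ (x ∘ σ) = ρ x
  moment : ∀ (j : ℕ) (A : Fin j → Set S) (c : Fin m → Fin j),
    (∀ i, @MeasurableSet S F (A i)) → Pairwise (fun i i' => Disjoint (A i) (A i')) →
    @MomentIdentity S _ M G μ lam m ρ j A c

/-! ### `α`-determinants and `α`-determinantal point processes -/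

/-- The number of cycles of a permutation, fixed points included. -/
def numCycles {m : ℕ} (σ : Equiv.Perm (Fin m)) : ℕ :=
  Multiset.card σ.cycleType + (Finset.univ.filter fun i => σ i = i).card

/-- The `α`-determinant `∑ σ, α ^ (m - ν(σ)) ∏ i, a_{i, σ(i)}`. -/
def alphaDet (α : ℝ) {m : ℕ} (a : Matrix (Fin m) (Fin m) ℂ) : ℂ :=
  ∑ σ : Equiv.Perm (Fin m), (α : ℂ) ^ (m - numCycles σ) * ∏ i, a i (σ i)

/-- `μ` is an `α`-determinantal point process associated with `(k, lam)`: a probability measure on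
the configuration space whose `m`-point correlation function is the `α`-determinant of `k`
(correlation functions being defined up to null sets) for every `m`. -/
structure IsAlphaDeterminantal {S : Type*} [TopologicalSpace S] [MeasurableSpace S]
    (α : ℝ) (k : S → S → ℂ) (lam : Measure S) (μ : Measure (Conf S)) : Prop where
  isProbabilityMeasure : IsProbabilityMeasure μ
  correlation : ∀ m : ℕ, ∃ ρ : (Fin m → S) → ℝ≥0, IsCorrelationFunction μ lam inferInstance m ρ ∧
    ∀ᵐ x ∂(Measure.pi fun _ : Fin m => lam),
      ((ρ x : ℝ) : ℂ) = alphaDet α (Matrix.of fun p q => k (x p) (x q))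

/-! ### Integral operators, trace class -/

/-- `T` is the operator `f ↦ ∫ k(·, y) f(y) lam(dy)` on `L²(lam)`. -/
def IsIntegralOperator {S : Type*} [MeasurableSpace S] (lam : Measure S) (k : S → S → ℂ)
    (T : Lp ℂ 2 lam →L[ℂ] Lp ℂ 2 lam) : Prop :=
  ∀ f : Lp ℂ 2 lam, ∀ᵐ x ∂lam,
    Integrable (fun y => k x y * f y) lam ∧ T f x = ∫ y, k x y * f y ∂lam

/-- The kernel `1_A(x) k(x, y) 1_A(y)`. -/
def cutKernel {S : Type*} (A : Set S) (k : S → S → ℂ) (x y : S) : ℂ :=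
  (A ×ˢ A).indicator (fun z => k z.1 z.2) (x, y)

/-- `∑ ⟨b, T b⟩ = t` for every orthonormal basis (given as a subset of the space). -/
def HasTrace {H : Type*} [NormedAddCommGroup H] [InnerProductSpace ℂ H]
    (T : H →L[ℂ] H) (t : ℂ) : Prop :=
  ∀ (w : Set H) (b : HilbertBasis w ℂ H), (⇑b = fun i : w => (i : H)) →
    HasSum (fun i : w => ⟪b i, T (b i)⟫_ℂ) t

/-- `T` is of trace class: `|T| = √(T* T)` has a finite trace. -/
def IsTraceClass {H : Type*} [NormedAddCommGroup H] [InnerProductSpace ℂ H] [CompleteSpace H]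
    (T : H →L[ℂ] H) : Prop :=
  ∃ t : ℂ, HasTrace (CFC.abs T) t

/-- The standing assumptions on `α` and on the kernel `k`. -/
structure AdmissibleKernel {S : Type*} [TopologicalSpace S] [MeasurableSpace S]
    (lam : Measure S) (α : ℝ) (k : S → S → ℂ) : Prop where
  alpha_mem : ∃ q : ℕ, 0 < q ∧ (α = 2 / (q : ℝ) ∨ α = -1 / (q : ℝ))
  measurable : Measurable fun z : S × S => k z.1 z.2
  hermitian : ∀ x y, k x y = (starRingEnd ℂ) (k y x)
  /-- `k` defines a bounded operator on `L²(lam)` with spectrum in `[0, ∞)`, and even in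
  `[0, -1/α]` if `α < 0`. -/
  spec : ∃ T : Lp ℂ 2 lam →L[ℂ] Lp ℂ 2 lam, IsIntegralOperator lam k T ∧
    (∀ z ∈ spectrum ℂ T, ∃ r : ℝ, z = r ∧ 0 ≤ r ∧ (α < 0 → r ≤ -1 / α))
  locallyTraceClass : ∀ C : Set S, IsCompact C →
    ∃ T : Lp ℂ 2 lam →L[ℂ] Lp ℂ 2 lam, IsIntegralOperator lam (cutKernel C k) T ∧ IsTraceClass T
  /-- The kernel of a locally trace class operator is determined only up to null sets of the
  product, which says nothing about the diagonal; the version `k` is one that computes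
  traces on relatively compact sets. -/
  trace_eq : ∀ A : Set S, MeasurableSet A → IsCompact (closure A) →
    IntegrableOn (fun x => k x x) A lam ∧
    ∃ T : Lp ℂ 2 lam →L[ℂ] Lp ℂ 2 lam, IsIntegralOperator lam (cutKernel A k) T ∧
      HasTrace T (∫ x in A, k x x ∂lam)

/-! ### Tree indices -/

/-- `J × {0,1}^n`; the digits `0`, `1` are `false`, `true`. -/
abbrev Label (J : Type*) (n : ℕ) : Type _ := J × (Fin n → Bool)

/-- `(j_1, …, j_{n+1})⁻ = (j_1, …, j_n)`. -/
def Label.parent {J : Type*} {n : ℕ} (i : Label J (n + 1)) : Label J n := (i.1, Fin.init i.2)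

/-- The full binary trees with roots `J`: the disjoint union of `J × {0,1}^n`, `n ≥ 0`.
An element of `J × {0,1}^n` has rank `n + 1`. -/
def FullTree (J : Type*) : Type _ := Σ n : ℕ, Label J n

/-- The node is a root, or its last digit is `0`. -/
def FullTree.IsLeft {J : Type*} : FullTree J → Prop
  | ⟨0, _⟩ => True
  | ⟨n + 1, i⟩ => i.2 (Fin.last n) = false

/-- The tree index set with roots `J`: the roots, and all nodes of rank at least `2` with last
digit `0`.  The set `𝕀` is `Tree I`, and `𝕀(ℓ)` is `Tree (Label I (ℓ - 1))`, whose roots are the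
labels of level `ℓ`. -/
def Tree (J : Type*) : Type _ := {t : FullTree J // t.IsLeft}

/-- The rank minus one. -/
def Tree.depth {J : Type*} (t : Tree J) : ℕ := t.1.1

instance (J : Type*) : TopologicalSpace (Tree J) := ⊥
instance (J : Type*) : DiscreteTopology (Tree J) := ⟨rfl⟩
instance (J : Type*) : MeasurableSpace (Tree J) := ⊤
instance (J : Type*) : DiscreteMeasurableSpace (Tree J) := ⟨fun _ => trivial⟩

/-- The inverse of the shift of labels:
`((j_1, …, j_ℓ), j_{ℓ+1}, …, j_{ℓ+r-1}) ↦ (j_1, …, j_{ℓ+r-1})`, where `ℓ = n + 1`. -/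
def unshift {I : Type*} {n : ℕ} : FullTree (Label I n) → FullTree I
  | ⟨k, (i, v)⟩ => ⟨n + k, (i.1, Fin.append i.2 v)⟩

theorem unshift_isLeft {I : Type*} {n k : ℕ} (i : Label (Label I n) (k + 1))
    (h : FullTree.IsLeft ⟨k + 1, i⟩) : (unshift ⟨k + 1, i⟩).IsLeft := by
  obtain ⟨i, v⟩ := i
  change Fin.append i.2 v (Fin.last (n + k)) = false
  have e : Fin.last (n + k) = Fin.natAdd n (Fin.last k) := rfl
  rw [e, Fin.append_right]
  exact h

/-! ### Nested partitions -/

/-- A sequence of `lam`-partitions of `S` into relatively compact cells of positive measure, each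
cell of one level being split into two cells of the next level, such that the cells generate
the Borel σ-field.  `cell n` is the partition of level `n + 1`, labelled by `I × {0,1}^n` in such
a way that `cell n i ⊇ cell (n + 1) i'` exactly if `i = i'.parent` (the other containments are
excluded as the cells of level `n + 1` are non-empty and those of level `n` disjoint). -/
structure BinaryPartitions {S : Type*} [TopologicalSpace S] [MeasurableSpace S]
    (lam : Measure S) (I : Type*) where
  cell : ∀ n : ℕ, Label I n → Set S
  measurableSet_cell : ∀ n i, MeasurableSet (cell n i)
  isCompact_closure : ∀ n i, IsCompact (closure (cell n i))
  pairwise_disjoint : ∀ n, Pairwise fun i i' => Disjoint (cell n i) (cell n i')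
  iUnion_cell : ∀ n, ⋃ i, cell n i = univ
  measure_pos : ∀ n i, 0 < lam (cell n i)
  cell_subset_parent : ∀ n (i : Label I (n + 1)), cell (n + 1) i ⊆ cell n i.parent
  generate : ⨆ n, MeasurableSpace.generateFrom (range (cell n)) = borel S

namespace BinaryPartitions

variable {S I : Type*} [TopologicalSpace S] [MeasurableSpace S] {lam : Measure S}
  (P : BinaryPartitions lam I)

/-- The σ-field on `S` generated by the cells of level `n + 1`. -/
abbrev sigmaField (n : ℕ) : MeasurableSpace S := MeasurableSpace.generateFrom (range (P.cell n))

/-- The σ-field on the configuration space generated by the events `{s(A) = r}`,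
`A` a cell of level `n + 1`, `r` a natural number. -/
abbrev countField (n : ℕ) : MeasurableSpace (Conf S) :=
  MeasurableSpace.generateFrom
    {E | ∃ (i : Label I n) (r : ℕ), E = {s : Conf S | s.count (P.cell n i) = r}}

theorem countField_le (n : ℕ) :
    P.countField n ≤ (inferInstance : MeasurableSpace (Conf S)) := by
  refine MeasurableSpace.generateFrom_le ?_
  rintro _ ⟨i, r, rfl⟩
  exact Conf.measurable_count (P.measurableSet_cell n i) (measurableSet_singleton _)

/-- The set `B_i`: the cell of `i` if `i` has rank `1`, and the cell of the parent of `i`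
otherwise. -/
def nodeSet : FullTree I → Set S
  | ⟨0, i⟩ => P.cell 0 i
  | ⟨k + 1, i⟩ => P.cell k i.parent

/-- The set `B_{ℓ,i}` for `ℓ = n + 1`: the cell of `i` if `i` has rank `1`, and `B_j` with `j` the
label `i` shifted back otherwise. -/
def levelNodeSet (n : ℕ) : FullTree (Label I n) → Set S
  | ⟨0, i⟩ => P.cell n i.1
  | ⟨k + 1, i⟩ => P.nodeSet (unshift ⟨k + 1, i⟩)

/-- `f = (f_i)` is an orthonormal basis of `L²(lam)` of real functions, indexed by `𝕀`, adapted to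
the partitions. -/
structure IsTreeBasis (f : Tree I → S → ℝ) : Prop where
  sigma_eq : ∀ k : ℕ,
    ⨆ i : {t : Tree I // t.depth = k}, MeasurableSpace.comap (f i.1) (borel ℝ) = P.sigmaField k
  support_eq : ∀ t : Tree I, Function.support (f t) = P.nodeSet t.1
  root_eq : ∀ i : Label I 0, f ⟨⟨0, i⟩, trivial⟩ =
    (P.cell 0 i).indicator fun _ => 1 / √(lam (P.cell 0 i)).toReal
  orthonormalBasis : ∃ b : HilbertBasis (Tree I) ℂ (Lp ℂ 2 lam),
    ∀ t, b t =ᵐ[lam] fun x => (f t x : ℂ)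

/-- The basis functions `f_{ℓ,i}` of level `ℓ = n + 1`: the normalized indicator of the cell of `i`
if `i` has rank `1`, and `f_j` with `j` the label `i` shifted back otherwise. -/
def levelFun (f : Tree I → S → ℝ) (n : ℕ) : Tree (Label I n) → S → ℝ
  | ⟨⟨0, i⟩, _⟩ => (P.cell n i.1).indicator fun _ => 1 / √(lam (P.cell n i.1)).toReal
  | ⟨⟨k + 1, i⟩, h⟩ => f ⟨unshift ⟨k + 1, i⟩, unshift_isLeft i h⟩

/-- The kernel `K_{F(ℓ)}(i, j) = ∫∫ k(x, y) f_{ℓ,i}(x) f_{ℓ,j}(y) lam(dx) lam(dy)`, `ℓ = n + 1`. -/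
def levelKernel (k : S → S → ℂ) (f : Tree I → S → ℝ) (n : ℕ) (i j : Tree (Label I n)) : ℂ :=
  ∫ z : S × S, k z.1 z.2 * (P.levelFun f n i z.1 : ℂ) * (P.levelFun f n j z.2 : ℂ) ∂(lam.prod lam)

/-- The set `𝕀_ℓ(A_1) × ⋯ × 𝕀_ℓ(A_m)`, where `𝕀_ℓ(A) = {i ∈ 𝕀(ℓ) | B_{ℓ,i} ⊆ A}` and
`ℓ = n + 1`. -/
def treeBox (n : ℕ) {m : ℕ} (A : Fin m → Set S) : Set (Fin m → Tree (Label I n)) :=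
  {i | ∀ p, P.levelNodeSet n (i p).1 ⊆ A p}

end BinaryPartitions

end TreeRep

end

/-! Expand the `α`-determinant over permutations `σ`. On a product of cells each term is the
integral of `∏ k (x p) (x (σ p))`, with every factor cut to a product of two cells. The theorem thus
reduces to a Parseval identity for each `σ`: this integral is the limit, over finite sets of nodes,
of sums of the same product formed from the coefficients of `k` in the tensor products of the
functions of level `ℓ`. For a finite expansion of the kernel the identity is exact by orthonormality
(`integral_prod_partialKernel`).

The passage to the limit needs two kinds of convergence. On the points moved by `σ` every variable
occurs in exactly two different factors. Repeated use of Cauchy–Schwarz then bounds the integral by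
the product of the `L²` norms of the factors (`lintegral_prod_pair_le`), so `L²` convergence of the
cut kernels suffices (`tendsto_integral_prod_pair`). A fixed point contributes the integral of `k x
x` over a cell. `L²` convergence does not see the diagonal; here the trace formula of the kernel
identifies the integral with the sum of the diagonal coefficients (`hasSum_kernelCoeff_diag`).

The `L²` expansion rests on two facts. The functions of a level form a complete system: a function
orthogonal to all of them has integral zero over every cell (`setIntegral_cell_eq_zero`), and the
cells generate the Borel sets (`ae_eq_zero_of_setIntegral_cell`). The kernel is square integrable on
products of cells, because a trace class operator is Hilbert–Schmidt (`memLp_kernel`).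

Correlation functions enter only at the end. By the moment identity, those of `μ` and of its
restriction have equal integrals over products of cells (`IsCorrelationFunction.lintegral_box_eq`).
On the countable tree, the correlation function equals the `α`-determinant at every tuple. Its
non-negativity turns the limit along finite boxes into the full sum. The analysis is done for trees
with arbitrary roots `J`, and applied with the labels of level `ℓ` as roots. -/

namespace TreeRep

/-! ### Labels and cells -/

/-- The child `(j_1, …, j_{n+1}, b)` of a label. -/
def Label.child {J : Type*} {n : ℕ} (i : Label J n) (b : Bool) : Label J (n + 1) :=
  (i.1, Fin.snoc i.2 b)

@[simp]
theorem Label.parent_child {J : Type*} {n : ℕ} (i : Label J n) (b : Bool) :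
    (i.child b).parent = i := by
  simp [Label.parent, Label.child]

@[simp]
theorem Label.child_parent {J : Type*} {n : ℕ} (i : Label J (n + 1)) :
    i.parent.child (i.2 (Fin.last n)) = i := by
  simp [Label.parent, Label.child]

theorem Label.child_ne {J : Type*} {n : ℕ} (i : Label J n) : i.child false ≠ i.child true := by
  intro h
  have := congrArg (fun l : Label J (n + 1) => l.2 (Fin.last n)) h
  simp [Label.child] at this

/-- The root `j` as a label of level one. -/
def Label.root {J : Type*} (j : J) : Label J 0 := (j, Fin.elim0)

theorem Label.eq_root {J : Type*} (i : Label J 0) : i = Label.root i.1 :=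
  Prod.ext rfl (Subsingleton.elim _ _)

/-- The root of the tree that contains the node. -/
def Tree.base {J : Type*} (t : Tree J) : J := t.1.2.1

/-- The root `j` as a node. -/
def Tree.root {J : Type*} (j : J) : Tree J := ⟨⟨0, Label.root j⟩, trivial⟩

/-- The node that represents the split of the cell of `i` into two cells. -/
def Tree.split {J : Type*} {n : ℕ} (i : Label J n) : Tree J :=
  ⟨⟨n + 1, i.child false⟩, by simp [FullTree.IsLeft, Label.child]⟩

theorem Tree.eq_root_or_split {J : Type*} (t : Tree J) :
    t = Tree.root t.base ∨ ∃ i : Label J (t.depth - 1), 0 < t.depth ∧ t = Tree.split i := by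
  obtain ⟨⟨k, i⟩, h⟩ := t
  cases k with
  | zero => exact Or.inl (Subtype.ext (congrArg (Sigma.mk 0) i.eq_root))
  | succ k =>
    refine Or.inr ⟨i.parent, Nat.succ_pos k, Subtype.ext ?_⟩
    have h' : i.2 (Fin.last k) = false := h
    have e := i.child_parent
    rw [h'] at e
    exact congrArg (Sigma.mk (k + 1)) e.symm

/-- Induction on the shape of a node. -/
theorem Tree.root_or_split {J : Type*} {p : Tree J → Prop} (root : ∀ j, p (Tree.root j))
    (split : ∀ (n : ℕ) (i : Label J n), p (Tree.split i)) (t : Tree J) : p t := by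
  rcases t.eq_root_or_split with h | ⟨i, _, h⟩
  · rw [h]; exact root _
  · rw [h]; exact split _ i

theorem Tree.split_inj {J : Type*} {n : ℕ} {i i' : Label J n}
    (h : Tree.split i = Tree.split i') : i = i' := by
  have h1 := congrArg Subtype.val h
  have h2 : i.child false = i'.child false := eq_of_heq (Sigma.mk.inj h1).2
  simpa using congrArg Label.parent h2

instance (J : Type*) [Countable J] : Countable (Tree J) :=
  haveI : Countable (FullTree J) := inferInstanceAs (Countable (Σ n : ℕ, J × (Fin n → Bool)))
  inferInstanceAs (Countable {t : FullTree J // t.IsLeft})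

namespace BinaryPartitions

section Cells

variable {S J : Type*} [TopologicalSpace S] [MeasurableSpace S] {lam : Measure S}
  (P : BinaryPartitions lam J)

theorem cell_nonempty (n : ℕ) (i : Label J n) : (P.cell n i).Nonempty :=
  nonempty_of_measure_ne_zero (P.measure_pos n i).ne'

theorem cell_eq_of_mem {n : ℕ} {i i' : Label J n} {x : S} (h : x ∈ P.cell n i)
    (h' : x ∈ P.cell n i') : i = i' := by
  by_contra hne
  exact (P.pairwise_disjoint n hne).le_bot ⟨h, h'⟩

theorem exists_mem_cell (n : ℕ) (x : S) : ∃ i, x ∈ P.cell n i := by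
  have : x ∈ ⋃ i, P.cell n i := by rw [P.iUnion_cell]; trivial
  simpa using this

theorem cell_child_subset {n : ℕ} (i : Label J n) (b : Bool) :
    P.cell (n + 1) (i.child b) ⊆ P.cell n i := by
  simpa using P.cell_subset_parent n (i.child b)

theorem cell_eq_union {n : ℕ} (i : Label J n) :
    P.cell n i = P.cell (n + 1) (i.child false) ∪ P.cell (n + 1) (i.child true) := by
  refine Subset.antisymm (fun x hx => ?_)
    (union_subset (P.cell_child_subset i _) (P.cell_child_subset i _))
  obtain ⟨i', hi'⟩ := P.exists_mem_cell (n + 1) x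
  have h : i'.parent = i := P.cell_eq_of_mem (P.cell_subset_parent n i' hi') hx
  have e := i'.child_parent
  rw [h] at e
  cases hb : i'.2 (Fin.last n) <;> rw [hb] at e <;> rw [← e] at hi'
  · exact Or.inl hi'
  · exact Or.inr hi'

theorem disjoint_child {n : ℕ} (i : Label J n) :
    Disjoint (P.cell (n + 1) (i.child false)) (P.cell (n + 1) (i.child true)) :=
  P.pairwise_disjoint (n + 1) i.child_ne

theorem cell_subset_root (n : ℕ) (i : Label J n) : P.cell n i ⊆ P.cell 0 (Label.root i.1) := by
  induction n with
  | zero => rw [i.eq_root]; exact subset_rfl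
  | succ n ih => exact (P.cell_subset_parent n i).trans (ih i.parent)

/-- Two cells are nested or disjoint. -/
theorem cell_subset_or_disjoint {n m : ℕ} (h : n ≤ m) (i : Label J n) (i' : Label J m) :
    P.cell m i' ⊆ P.cell n i ∨ Disjoint (P.cell m i') (P.cell n i) := by
  induction m, h using Nat.le_induction with
  | base =>
    by_cases e : i' = i
    · exact Or.inl (by rw [e])
    · exact Or.inr (P.pairwise_disjoint n e)
  | succ m _ ih =>
    rcases ih i'.parent with h | h
    · exact Or.inl ((P.cell_subset_parent m i').trans h)
    · exact Or.inr (h.mono_left (P.cell_subset_parent m i'))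

theorem sigmaField_mono : Monotone P.sigmaField := by
  refine monotone_nat_of_le_succ fun n => MeasurableSpace.generateFrom_le ?_
  rintro _ ⟨i, rfl⟩
  rw [P.cell_eq_union i]
  exact @MeasurableSet.union _ (P.sigmaField (n + 1)) _ _
    (MeasurableSpace.measurableSet_generateFrom ⟨_, rfl⟩)
    (MeasurableSpace.measurableSet_generateFrom ⟨_, rfl⟩)

/-- A set of the σ-field of a level is a union of cells of that level. -/
theorem mem_iff_of_measurableSet {n : ℕ} {A : Set S} (hA : MeasurableSet[P.sigmaField n] A)
    {i : Label J n} {x y : S} (hx : x ∈ P.cell n i) (hy : y ∈ P.cell n i) : x ∈ A ↔ y ∈ A := by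
  induction A, hA using MeasurableSpace.generateFrom_induction with
  | hC t ht _ =>
    obtain ⟨i', rfl⟩ := ht
    constructor <;> intro h
    · rwa [P.cell_eq_of_mem h hx]
    · rwa [P.cell_eq_of_mem h hy]
  | empty => simp
  | compl t _ ih => exact not_congr ih
  | iUnion s _ ih => simp only [mem_iUnion]; exact exists_congr ih

theorem cell_ne_top [IsFiniteMeasureOnCompacts lam] (n : ℕ) (i : Label J n) :
    lam (P.cell n i) ≠ ∞ :=
  (((measure_mono subset_closure).trans_lt (P.isCompact_closure n i).measure_lt_top)).ne

theorem cell_toReal_pos [IsFiniteMeasureOnCompacts lam] (n : ℕ) (i : Label J n) :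
    0 < (lam (P.cell n i)).toReal :=
  ENNReal.toReal_pos (P.measure_pos n i).ne' (P.cell_ne_top n i)

theorem nodeSet_root (j : J) : P.nodeSet (Tree.root j).1 = P.cell 0 (Label.root j) := rfl

theorem nodeSet_split {n : ℕ} (i : Label J n) : P.nodeSet (Tree.split i).1 = P.cell n i := by
  change P.cell n (i.child false).parent = _
  rw [Label.parent_child]

theorem nodeSet_subset (t : Tree J) : P.nodeSet t.1 ⊆ P.cell 0 (Label.root t.base) := by
  refine Tree.root_or_split (p := fun t => P.nodeSet t.1 ⊆ P.cell 0 (Label.root t.base))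
    (fun j => subset_rfl) (fun n i => ?_) t
  rw [P.nodeSet_split]
  exact P.cell_subset_root n i

theorem nodeSet_nonempty (t : Tree J) : (P.nodeSet t.1).Nonempty := by
  refine Tree.root_or_split (p := fun t => (P.nodeSet t.1).Nonempty)
    (fun j => P.cell_nonempty _ _) (fun n i => ?_) t
  rw [P.nodeSet_split]
  exact P.cell_nonempty n i

theorem nodeSet_subset_cell_iff (t : Tree J) (j : Label J 0) :
    P.nodeSet t.1 ⊆ P.cell 0 j ↔ t.base = j.1 := by
  refine ⟨fun h => ?_, fun h => ?_⟩
  · obtain ⟨x, hx⟩ := P.nodeSet_nonempty t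
    exact congrArg Prod.fst (P.cell_eq_of_mem (P.nodeSet_subset t hx) (h hx))
  · rw [j.eq_root, ← h]
    exact P.nodeSet_subset t

end Cells

/-! ### Haar systems -/

/-- A family of step functions indexed by the tree, orthonormal and adapted to the partitions. -/
structure IsHaarSystem {S J : Type*} [TopologicalSpace S] [MeasurableSpace S] {lam : Measure S}
    (P : BinaryPartitions lam J) (e : Tree J → S → ℝ) : Prop where
  const : ∀ (t : Tree J) (i : Label J t.depth) (x y : S), x ∈ P.cell t.depth i →
    y ∈ P.cell t.depth i → e t x = e t y
  support_eq : ∀ t : Tree J, Function.support (e t) = P.nodeSet t.1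
  root_eq : ∀ j : J, e (Tree.root j) =
    (P.cell 0 (Label.root j)).indicator fun _ => 1 / √(lam (P.cell 0 (Label.root j))).toReal
  integral_sq : ∀ t, ∫ x, e t x * e t x ∂lam = 1
  integral_mul : ∀ t s, t ≠ s → ∫ x, e t x * e s x ∂lam = 0

namespace IsHaarSystem

section Basic

variable {S J : Type*} [TopologicalSpace S] [MeasurableSpace S] {lam : Measure S}
  {P : BinaryPartitions lam J} {e : Tree J → S → ℝ}

/-- A split node over a cell of level `n` has depth `n + 1`: its function is constant on each of the
two children of that cell, and its support is the whole cell, so neither value is zero. -/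
theorem exists_split_eq (h : P.IsHaarSystem e) {n : ℕ} (i : Label J n) :
    ∃ c₀ c₁ : ℝ, c₀ ≠ 0 ∧ c₁ ≠ 0 ∧ e (Tree.split i) =
      (P.cell (n + 1) (i.child false)).indicator (fun _ => c₀) +
        (P.cell (n + 1) (i.child true)).indicator (fun _ => c₁) := by
  obtain ⟨x₀, h₀⟩ := P.cell_nonempty (n + 1) (i.child false)
  obtain ⟨x₁, h₁⟩ := P.cell_nonempty (n + 1) (i.child true)
  have hs : ∀ x, e (Tree.split i) x ≠ 0 ↔ x ∈ P.cell n i := fun x => by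
    rw [← Function.mem_support, h.support_eq, P.nodeSet_split]
  refine ⟨e (Tree.split i) x₀, e (Tree.split i) x₁, (hs _).2 (P.cell_child_subset i _ h₀),
    (hs _).2 (P.cell_child_subset i _ h₁), ?_⟩
  funext x
  by_cases hx₀ : x ∈ P.cell (n + 1) (i.child false)
  · have hx₁ : x ∉ P.cell (n + 1) (i.child true) := fun hx =>
      (P.disjoint_child i).le_bot ⟨hx₀, hx⟩
    simp only [Pi.add_apply, indicator_of_mem hx₀, indicator_of_notMem hx₁, add_zero]
    exact h.const (Tree.split i) _ _ _ hx₀ h₀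
  · by_cases hx₁ : x ∈ P.cell (n + 1) (i.child true)
    · simp only [Pi.add_apply, indicator_of_mem hx₁, indicator_of_notMem hx₀, zero_add]
      exact h.const (Tree.split i) _ _ _ hx₁ h₁
    · simp only [Pi.add_apply, indicator_of_notMem hx₁, indicator_of_notMem hx₀, zero_add]
      by_contra hne
      have := (hs x).1 hne
      rw [P.cell_eq_union] at this
      exact this.elim hx₀ hx₁

theorem measurable (h : P.IsHaarSystem e) (t : Tree J) : Measurable (e t) := by
  refine Tree.root_or_split (p := fun t => Measurable (e t)) (fun j => ?_) (fun n i => ?_) t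
  · rw [h.root_eq]
    exact measurable_const.indicator (P.measurableSet_cell _ _)
  · obtain ⟨c₀, c₁, -, -, he⟩ := h.exists_split_eq i
    rw [he]
    exact (measurable_const.indicator (P.measurableSet_cell _ _)).add
      (measurable_const.indicator (P.measurableSet_cell _ _))

theorem exists_bound (h : P.IsHaarSystem e) (t : Tree J) : ∃ C, ∀ x, ‖e t x‖ ≤ C := by
  refine Tree.root_or_split (p := fun t => ∃ C, ∀ x, ‖e t x‖ ≤ C) (fun j => ?_) (fun n i => ?_) t
  · rw [h.root_eq]
    exact ⟨_, fun x => norm_indicator_le_norm_self _ x⟩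
  · obtain ⟨c₀, c₁, -, -, he⟩ := h.exists_split_eq i
    rw [he]
    exact ⟨‖c₀‖ + ‖c₁‖, fun x => (norm_add_le _ _).trans
      (add_le_add (norm_indicator_le_norm_self _ x) (norm_indicator_le_norm_self _ x))⟩

theorem eq_zero (h : P.IsHaarSystem e) {t : Tree J} {x : S}
    (hx : x ∉ P.cell 0 (Label.root t.base)) : e t x = 0 := by
  by_contra hne
  refine hx (P.nodeSet_subset t ?_)
  rwa [← h.support_eq]

/-- The product of a function integrable on cells with a function of the system. -/
theorem integrable_mul (h : P.IsHaarSystem e) {g : S → ℂ} (t : Tree J)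
    (hg : IntegrableOn g (P.cell 0 (Label.root t.base)) lam) :
    Integrable (fun x => (e t x : ℂ) * g x) lam := by
  obtain ⟨C, hC⟩ := h.exists_bound t
  have h1 : Integrable ((P.cell 0 (Label.root t.base)).indicator g) lam :=
    (integrable_indicator_iff (P.measurableSet_cell _ _)).2 hg
  have h2 : Integrable (fun x => (e t x : ℂ) * (P.cell 0 (Label.root t.base)).indicator g x) lam :=
    h1.bdd_mul (c := C) (Complex.measurable_ofReal.comp (h.measurable t)).aestronglyMeasurable
      (Filter.Eventually.of_forall fun x => by simpa using hC x)
  refine h2.congr (Filter.Eventually.of_forall fun x => ?_)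
  by_cases hx : x ∈ P.cell 0 (Label.root t.base)
  · simp [hx]
  · simp [h.eq_zero hx]

theorem memLp [IsFiniteMeasureOnCompacts lam] (h : P.IsHaarSystem e) (t : Tree J) (p : ℝ≥0∞) :
    MemLp (fun x => (e t x : ℂ)) p lam := by
  obtain ⟨C, hC⟩ := h.exists_bound t
  have h1 : MemLp (fun x => (e t x : ℂ)) p (lam.restrict (P.cell 0 (Label.root t.base))) := by
    have : IsFiniteMeasure (lam.restrict (P.cell 0 (Label.root t.base))) :=
      ⟨by simpa using (P.cell_ne_top _ _).lt_top⟩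
    exact MemLp.of_bound
      (Complex.measurable_ofReal.comp (h.measurable t)).aestronglyMeasurable C
      (Filter.Eventually.of_forall fun x => by simpa using hC x)
  rw [← memLp_indicator_iff_restrict (P.measurableSet_cell _ _)] at h1
  convert h1 using 1
  funext x
  by_cases hx : x ∈ P.cell 0 (Label.root t.base)
  · simp [hx]
  · simp [hx, h.eq_zero hx]

end Basic

end IsHaarSystem

end BinaryPartitions

end TreeRep

/-! ### Orthogonality and integrals over cells -/

namespace TreeRep

namespace BinaryPartitions

namespace IsHaarSystem

section Vanishing

variable {S J : Type*} [TopologicalSpace S] [MeasurableSpace S] {lam : Measure S}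
  {P : BinaryPartitions lam J} {e : Tree J → S → ℝ}

theorem integral_mul_root (h : P.IsHaarSystem e) (g : S → ℂ) (j : J) :
    ∫ x, (e (Tree.root j) x : ℂ) * g x ∂lam =
      ((1 / √(lam (P.cell 0 (Label.root j))).toReal : ℝ) : ℂ) *
        ∫ x in P.cell 0 (Label.root j), g x ∂lam := by
  rw [← integral_indicator (P.measurableSet_cell _ _), ← integral_const_mul, h.root_eq]
  congr 1
  funext x
  by_cases hx : x ∈ P.cell 0 (Label.root j) <;> simp [hx]

theorem integral_mul_split (h : P.IsHaarSystem e) {n : ℕ} (i : Label J n) :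
    ∃ c₀ c₁ : ℝ, c₀ ≠ 0 ∧ c₁ ≠ 0 ∧ ∀ g : S → ℂ, IntegrableOn g (P.cell n i) lam →
      ∫ x, (e (Tree.split i) x : ℂ) * g x ∂lam =
        c₀ * (∫ x in P.cell (n + 1) (i.child false), g x ∂lam) +
          c₁ * ∫ x in P.cell (n + 1) (i.child true), g x ∂lam := by
  obtain ⟨c₀, c₁, h₀, h₁, he⟩ := h.exists_split_eq i
  refine ⟨c₀, c₁, h₀, h₁, fun g hg => ?_⟩
  have i₀ := (integrable_indicator_iff (P.measurableSet_cell (n + 1) (i.child false))).2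
    (hg.mono_set (P.cell_child_subset i false))
  have i₁ := (integrable_indicator_iff (P.measurableSet_cell (n + 1) (i.child true))).2
    (hg.mono_set (P.cell_child_subset i true))
  rw [← integral_indicator (P.measurableSet_cell _ _),
    ← integral_indicator (P.measurableSet_cell _ _), ← integral_const_mul, ← integral_const_mul,
    ← integral_add (i₀.const_mul _) (i₁.const_mul _), he]
  congr 1
  funext x
  by_cases hx₀ : x ∈ P.cell (n + 1) (i.child false) <;>
    by_cases hx₁ : x ∈ P.cell (n + 1) (i.child true) <;> simp [hx₀, hx₁]; ring

variable [IsFiniteMeasureOnCompacts lam]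

/-- A function that is orthogonal to the functions of depth at most `k` has vanishing integrals over
the cells of the corresponding level. -/
theorem setIntegral_cell_eq_zero (h : P.IsHaarSystem e) (k : ℕ) {g : S → ℂ}
    (hg : ∀ j, IntegrableOn g (P.cell 0 (Label.root j)) lam)
    (hz : ∀ t : Tree J, t.depth ≤ k → ∫ x, (e t x : ℂ) * g x ∂lam = 0) (i : Label J k) :
    ∫ x in P.cell k i, g x ∂lam = 0 := by
  induction k generalizing g with
  | zero =>
    have h1 := hz (Tree.root i.1) le_rfl
    rw [h.integral_mul_root, mul_eq_zero, ← i.eq_root] at h1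
    refine h1.resolve_left ?_
    have := Real.sqrt_pos.2 (P.cell_toReal_pos 0 i)
    exact_mod_cast (one_div_pos.2 this).ne'
  | succ k ih =>
    have hint : ∀ {g : S → ℂ}, (∀ j, IntegrableOn g (P.cell 0 (Label.root j)) lam) →
        ∀ i : Label J k, IntegrableOn g (P.cell k i) lam := fun hg i =>
      (hg i.1).mono_set (P.cell_subset_root k i)
    have hsum : ∀ {g : S → ℂ}, (∀ j, IntegrableOn g (P.cell 0 (Label.root j)) lam) →
        ∀ i : Label J k, ∫ x in P.cell k i, g x ∂lam =
          (∫ x in P.cell (k + 1) (i.child false), g x ∂lam) +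
            ∫ x in P.cell (k + 1) (i.child true), g x ∂lam := fun hg i => by
      rw [P.cell_eq_union i, setIntegral_union (P.disjoint_child i) (P.measurableSet_cell _ _)
        ((hint hg i).mono_set (P.cell_child_subset i _))
        ((hint hg i).mono_set (P.cell_child_subset i _))]
    obtain ⟨c₀, c₁, h₀, h₁, he⟩ := h.integral_mul_split i.parent
    have hsplit := hz (Tree.split i.parent) le_rfl
    rw [he g (hint hg _)] at hsplit
    have hB := ih hg (fun t ht => hz t (ht.trans k.le_succ)) i.parent
    rw [hsum hg] at hB
    -- If the two values agreed, the squared norm of the split function would be `c₀` times its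
    -- integral over the parent cell. The induction hypothesis, applied to that function itself,
    -- makes this integral zero, against the normalization.
    have hc : (c₀ : ℂ) ≠ c₁ := by
      intro hc
      have hi : Integrable (fun x => (e (Tree.split i.parent) x : ℂ)) lam :=
        memLp_one_iff_integrable.1 (h.memLp _ 1)
      have h2 := ih (g := fun x => (e (Tree.split i.parent) x : ℂ)) (fun j => hi.integrableOn)
        (fun t ht => by
          have hne : t ≠ Tree.split i.parent := fun h => by
            rw [h] at ht; exact absurd ht (Nat.not_succ_le_self k)
          simp only [← Complex.ofReal_mul]
          rw [integral_complex_ofReal, h.integral_mul t _ hne, Complex.ofReal_zero]) i.parent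
      have h4 := he (fun x => (e (Tree.split i.parent) x : ℂ)) hi.integrableOn
      rw [← hc, ← mul_add, ← hsum (fun j => hi.integrableOn), h2, mul_zero] at h4
      simp only [← Complex.ofReal_mul] at h4
      rw [integral_complex_ofReal, h.integral_sq] at h4
      simp at h4
    -- The integrals over the two children satisfy two homogeneous linear equations, with
    -- coefficients `(1, 1)` and `(c₀, c₁)`; the system is regular since `c₀ ≠ c₁`.
    have hb : ∀ b, ∫ x in P.cell (k + 1) (i.parent.child b), g x ∂lam = 0 := by
      have e0 : ((c₀ : ℂ) - c₁) * ∫ x in P.cell (k + 1) (i.parent.child false), g x ∂lam = 0 := by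
        linear_combination hsplit - c₁ * hB
      have e1 := (mul_eq_zero.1 e0).resolve_left (sub_ne_zero.2 hc)
      rw [e1, zero_add] at hB
      intro b
      cases b
      · exact e1
      · exact hB
    simpa using hb (i.2 (Fin.last k))

end Vanishing

/-! ### Completeness of Haar systems -/

section Uniqueness

variable {S J : Type*} [TopologicalSpace S] [MeasurableSpace S] [BorelSpace S] {lam : Measure S}
  [Countable J]
  {P : BinaryPartitions lam J} {e : Tree J → S → ℝ}

/-- Cells are nested or disjoint, so together with `∅` they form a π-system generating the Borel
sets, and a Dynkin argument passes from cells to all Borel sets. It runs inside one root cell at a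
time, since `g` need not be integrable on all of `S`; the root cells are countably many and cover
`S`. -/
theorem _root_.TreeRep.BinaryPartitions.ae_eq_zero_of_setIntegral_cell
    (P : BinaryPartitions lam J) {g : S → ℂ}
    (hg : ∀ j, IntegrableOn g (P.cell 0 (Label.root j)) lam)
    (hz : ∀ k i, ∫ x in P.cell k i, g x ∂lam = 0) : g =ᵐ[lam] 0 := by
  have hgen : (inferInstance : MeasurableSpace S) =
      MeasurableSpace.generateFrom (insert ∅ (⋃ n, range (P.cell n))) := by
    rw [MeasurableSpace.generateFrom_insert_empty, ← MeasurableSpace.iSup_generateFrom, P.generate]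
    exact BorelSpace.measurable_eq
  have hpi : IsPiSystem (insert ∅ (⋃ n, range (P.cell n))) := by
    refine IsPiSystem.insert_empty ?_
    have key : ∀ {n m : ℕ}, n ≤ m → ∀ (i : Label J n) (i' : Label J m),
        (P.cell n i ∩ P.cell m i').Nonempty → P.cell n i ∩ P.cell m i' = P.cell m i' := by
      intro n m hnm i i' hne
      rcases P.cell_subset_or_disjoint hnm i i' with h | h
      · exact inter_eq_self_of_subset_right h
      · exact absurd hne (by rw [inter_comm, not_nonempty_iff_eq_empty]; exact h.inter_eq)
    rintro s hs t ht hne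
    obtain ⟨n, i, rfl⟩ := mem_iUnion.1 hs
    obtain ⟨m, i', rfl⟩ := mem_iUnion.1 ht
    rcases le_total n m with hnm | hnm
    · rw [key hnm i i' hne]; exact ht
    · rw [inter_comm, key hnm i' i (by rwa [inter_comm])]; exact hs
  have hcell : ∀ j, ∀ A, MeasurableSet A → ∫ x in A ∩ P.cell 0 (Label.root j), g x ∂lam = 0 := by
    intro j A hA
    have hint : ∀ A, IntegrableOn g (A ∩ P.cell 0 (Label.root j)) lam := fun A =>
      (hg j).mono_set inter_subset_right
    induction A, hA using MeasurableSpace.induction_on_inter hgen hpi with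
    | empty => simp
    | basic A hA =>
      rcases hA with rfl | hA
      · simp
      obtain ⟨n, i, rfl⟩ := mem_iUnion.1 hA
      rcases P.cell_subset_or_disjoint (Nat.zero_le n) (Label.root j) i with h | h
      · rw [inter_eq_self_of_subset_left h]; exact hz n i
      · rw [h.inter_eq]; simp
    | compl A hA ih =>
      have h1 := integral_inter_add_sdiff (μ := lam) (f := g) (s := P.cell 0 (Label.root j)) hA (hg j)
      rw [inter_comm, ih, zero_add, hz] at h1
      rwa [sdiff_eq, inter_comm] at h1
    | iUnion s hd hs ih =>
      rw [iUnion_inter, integral_iUnion (fun n => (hs n).inter (P.measurableSet_cell _ _))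
        (fun n m hnm => (hd hnm).mono inter_subset_left inter_subset_left)
        ((hg j).mono_set (iUnion_subset fun n => inter_subset_right))]
      simp [ih]
  have hae : ∀ j, ∀ᵐ x ∂lam, x ∈ P.cell 0 (Label.root j) → g x = 0 := by
    intro j
    rw [← ae_restrict_iff' (P.measurableSet_cell _ _)]
    refine Integrable.ae_eq_zero_of_forall_setIntegral_eq_zero (hg j) fun s hs _ => ?_
    rw [Measure.restrict_restrict hs]
    exact hcell j s hs
  filter_upwards [ae_all_iff.2 hae] with x hx
  obtain ⟨i, hi⟩ := P.exists_mem_cell 0 x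
  rw [i.eq_root] at hi
  exact hx _ hi

variable [IsFiniteMeasureOnCompacts lam]

/-- A function, integrable on cells, that is orthogonal to a Haar system vanishes. -/
theorem ae_eq_zero (h : P.IsHaarSystem e) {g : S → ℂ}
    (hg : ∀ j, IntegrableOn g (P.cell 0 (Label.root j)) lam)
    (hz : ∀ t : Tree J, ∫ x, (e t x : ℂ) * g x ∂lam = 0) : g =ᵐ[lam] 0 :=
  P.ae_eq_zero_of_setIntegral_cell hg fun k i =>
    h.setIntegral_cell_eq_zero k hg (fun t _ => hz t) i

end Uniqueness

end IsHaarSystem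

section TreeBasis

variable {S I : Type*} [TopologicalSpace S] [MeasurableSpace S] {lam : Measure S}
  {P : BinaryPartitions lam I} {f : Tree I → S → ℝ}

/-- Measurability with respect to the σ-field of a level means constancy on its cells, and
orthonormality in complex `L²` gives the real integrals. Completeness is not recorded in
`IsHaarSystem`: it follows from the other properties, also for the systems of higher levels. -/
theorem IsTreeBasis.isHaarSystem (hf : P.IsTreeBasis f) : P.IsHaarSystem f := by
  classical
  have hin : ∀ t s, ∫ x, f t x * f s x ∂lam = if t = s then 1 else 0 := by
    obtain ⟨b, hb⟩ := hf.orthonormalBasis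
    intro t s
    have h1 := orthonormal_iff_ite.1 b.orthonormal t s
    rw [L2.inner_def] at h1
    have h2 : ∫ x, ⟪b t x, b s x⟫_ℂ ∂lam = ∫ x, ((f t x * f s x : ℝ) : ℂ) ∂lam := by
      refine integral_congr_ae ?_
      filter_upwards [hb t, hb s] with x hx hx'
      rw [hx, hx']
      simp [mul_comm]
    rw [h2, integral_complex_ofReal] at h1
    have h3 := congrArg Complex.re h1
    rw [apply_ite Complex.re] at h3
    simpa using h3
  refine ⟨fun t i x y hx hy => ?_, hf.support_eq, fun j => hf.root_eq _, fun t => by simp [hin],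
    fun t s h => by simp [hin, h]⟩
  have hle : MeasurableSpace.comap (f t) (borel ℝ) ≤ P.sigmaField t.depth := by
    rw [← hf.sigma_eq t.depth]
    exact le_iSup (fun i : {s : Tree I // s.depth = t.depth} =>
      MeasurableSpace.comap (f i.1) (borel ℝ)) ⟨t, rfl⟩
  -- A level set of `f t` belongs to the σ-field of the level, so it is a union of cells.
  have hm : MeasurableSet[P.sigmaField t.depth] (f t ⁻¹' {f t y}) :=
    hle _ ⟨{f t y}, by
    rw [← BorelSpace.measurable_eq (α := ℝ)]; exact measurableSet_singleton _, rfl⟩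
  exact (P.mem_iff_of_measurableSet hm hx hy).2 rfl

end TreeBasis

end BinaryPartitions

end TreeRep

namespace TreeRep

/-! ### Partitions and functions from a given level on -/

/-- A label over the labels of a level, read as a label. -/
def Label.flatten {I : Type*} {n k : ℕ} (i : Label (Label I n) k) : Label I (n + k) :=
  (i.1.1, Fin.append i.1.2 i.2)

theorem Label.flatten_injective {I : Type*} {n k : ℕ} :
    Function.Injective (Label.flatten : Label (Label I n) k → Label I (n + k)) := by
  rintro ⟨⟨a, u⟩, v⟩ ⟨⟨a', u'⟩, v'⟩ h
  obtain ⟨rfl, h2⟩ := Prod.ext_iff.1 h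
  have h3 := (Fin.appendEquiv n k).injective (a₁ := (u, v)) (a₂ := (u', v')) h2
  simp only [Prod.mk.injEq] at h3
  rw [h3.1, h3.2]
  rfl

theorem Label.flatten_surjective {I : Type*} {n k : ℕ} :
    Function.Surjective (Label.flatten : Label (Label I n) k → Label I (n + k)) := by
  rintro ⟨a, w⟩
  obtain ⟨⟨u, v⟩, h⟩ := (Fin.appendEquiv n k).surjective w
  exact ⟨((a, u), v), Prod.ext rfl h⟩

theorem Label.flatten_child {I : Type*} {n k : ℕ} (i : Label (Label I n) k) (b : Bool) :
    (i.child b).flatten = i.flatten.child b :=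
  Prod.ext rfl (Fin.append_snoc _ _ _)

theorem Label.flatten_parent {I : Type*} {n k : ℕ} (i : Label (Label I n) (k + 1)) :
    i.parent.flatten = Label.parent (n := n + k) i.flatten := by
  conv_rhs => rw [← i.child_parent, Label.flatten_child]
  exact (Label.parent_child _ _).symm

theorem Label.flatten_root {I : Type*} {n : ℕ} (i : Label I n) :
    (Label.root i).flatten = i :=
  Prod.ext rfl (Fin.append_right_nil _ _ rfl)

namespace BinaryPartitions

/-- The partitions from level `n + 1` on. -/
def shift {S I : Type*} [TopologicalSpace S] [MeasurableSpace S] {lam : Measure S}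
    (P : BinaryPartitions lam I) (n : ℕ) : BinaryPartitions lam (Label I n) where
  cell k i := P.cell (n + k) i.flatten
  measurableSet_cell _ _ := P.measurableSet_cell _ _
  isCompact_closure _ _ := P.isCompact_closure _ _
  pairwise_disjoint _ _ _ h := P.pairwise_disjoint _ fun h' => h (Label.flatten_injective h')
  iUnion_cell k := by
    rw [← P.iUnion_cell (n + k)]
    exact Label.flatten_surjective.iUnion_comp (P.cell (n + k))
  measure_pos _ _ := P.measure_pos _ _
  cell_subset_parent k i := by
    rw [Label.flatten_parent]
    exact P.cell_subset_parent (n + k) i.flatten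
  generate := by
    rw [← P.generate]
    have h : ∀ k, range (fun i : Label (Label I n) k => P.cell (n + k) i.flatten) =
        range (P.cell (n + k)) := fun k => Label.flatten_surjective.range_comp (P.cell (n + k))
    simp only [h]
    refine le_antisymm (iSup_le fun k => le_iSup P.sigmaField (n + k)) (iSup_le fun k => ?_)
    exact (P.sigmaField_mono (Nat.le_add_left k n)).trans
      (le_iSup (fun k => P.sigmaField (n + k)) k)

section Shift

variable {S I : Type*} [TopologicalSpace S] [MeasurableSpace S] {lam : Measure S}
  (P : BinaryPartitions lam I)

theorem shift_cell_root (n : ℕ) (i : Label I n) :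
    (P.shift n).cell 0 (Label.root i) = P.cell n i := by
  change P.cell n (Label.root i).flatten = _
  rw [Label.flatten_root]

theorem levelNodeSet_eq (n : ℕ) (t : Tree (Label I n)) :
    P.levelNodeSet n t.1 = (P.shift n).nodeSet t.1 := by
  refine Tree.root_or_split (p := fun t => P.levelNodeSet n t.1 = (P.shift n).nodeSet t.1)
    (fun j => ?_) (fun k i => ?_) t
  · rw [nodeSet_root, shift_cell_root]
    rfl
  · rw [nodeSet_split]
    change P.cell (n + k) (Label.parent (n := n + k) (i.child false).flatten) = P.cell (n + k) _
    rw [← Label.flatten_parent, Label.parent_child]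

theorem levelFun_root (f : Tree I → S → ℝ) (n : ℕ) (i : Label I n) :
    P.levelFun f n (Tree.root i) =
      (P.cell n i).indicator fun _ => 1 / √(lam (P.cell n i)).toReal :=
  rfl

theorem levelFun_split (f : Tree I → S → ℝ) (n k : ℕ) (i : Label (Label I n) k) :
    P.levelFun f n (Tree.split i) = f (Tree.split (n := n + k) i.flatten) := by
  change f ⟨⟨n + k + 1, (i.child false).flatten⟩, _⟩ = _
  refine congrArg f (Subtype.ext ?_)
  exact congrArg (Sigma.mk (n + k + 1)) (Label.flatten_child i false)

/-- For the shifted partitions the cell `a p` is a root cell, and a node set lies inside a root cell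
exactly when the node belongs to the tree of that root. -/
theorem mem_treeBox_iff (n : ℕ) {m : ℕ} (a : Fin m → Label I n)
    (i : Fin m → Tree (Label I n)) :
    i ∈ P.treeBox n (fun p => P.cell n (a p)) ↔ ∀ p, (i p).base = a p := by
  refine forall_congr' fun p => ?_
  change P.levelNodeSet n (i p).1 ⊆ P.cell n (a p) ↔ _
  rw [levelNodeSet_eq, ← shift_cell_root, nodeSet_subset_cell_iff]
  rfl

variable {P}

/-- The functions of level `n + 1` form a Haar system for the partitions from that level on. -/
theorem IsHaarSystem.levelFun [IsFiniteMeasureOnCompacts lam] {f : Tree I → S → ℝ}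
    (h : P.IsHaarSystem f) (n : ℕ) : (P.shift n).IsHaarSystem (P.levelFun f n) := by
  have hmul : ∀ i (s : Tree (Label I n)),
      (fun x => P.levelFun f n (Tree.root i) x * P.levelFun f n s x) =
      (P.cell n i).indicator fun x => 1 / √(lam (P.cell n i)).toReal * P.levelFun f n s x := by
    intro i s
    funext x
    rw [levelFun_root]
    by_cases hx : x ∈ P.cell n i <;> simp [hx]
  -- A split node from this level on has depth `n + k + 1 > n` in the original tree. Its function is
  -- therefore orthogonal to all functions of depth at most `n`, and so has integral zero over every
  -- cell of level `n`.
  have hsplit : ∀ i k (i' : Label (Label I n) k),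
      ∫ x, P.levelFun f n (Tree.root i) x * P.levelFun f n (Tree.split i') x ∂lam = 0 := by
    intro i k i'
    rw [hmul, integral_indicator (P.measurableSet_cell _ _), integral_const_mul, levelFun_split]
    have hi : Integrable (fun x => (f (Tree.split (n := n + k) i'.flatten) x : ℂ)) lam :=
      memLp_one_iff_integrable.1 (h.memLp _ 1)
    have h1 := h.setIntegral_cell_eq_zero n (fun j => hi.integrableOn) (fun t ht => by
      have hne : t ≠ Tree.split (n := n + k) i'.flatten := fun e => by
        rw [e] at ht
        exact absurd ht (by change ¬ n + k + 1 ≤ n; omega)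
      simp only [← Complex.ofReal_mul]
      rw [integral_complex_ofReal, h.integral_mul t _ hne, Complex.ofReal_zero]) i
    rw [integral_complex_ofReal] at h1
    rw [Complex.ofReal_eq_zero.1 h1, mul_zero]
  refine ⟨fun t => ?_, fun t => ?_, fun j => ?_, fun t => ?_, fun t s => ?_⟩
  · refine Tree.root_or_split (p := fun t => ∀ (i : Label (Label I n) t.depth) (x y : S),
      x ∈ (P.shift n).cell t.depth i → y ∈ (P.shift n).cell t.depth i →
      P.levelFun f n t x = P.levelFun f n t y) (fun j i x y hx hy => ?_)
      (fun k i i' x y hx hy => ?_) t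
    · have hxy : x ∈ P.cell n j ↔ y ∈ P.cell n j := by
        constructor <;> intro hj
        · rwa [← P.cell_eq_of_mem hx hj]
        · rwa [← P.cell_eq_of_mem hy hj]
      rw [levelFun_root]
      by_cases hx' : x ∈ P.cell n j
      · rw [indicator_of_mem hx', indicator_of_mem (hxy.1 hx')]
      · rw [indicator_of_notMem hx', indicator_of_notMem (fun h => hx' (hxy.2 h))]
    · rw [levelFun_split]
      exact h.const (Tree.split (n := n + k) i.flatten) i'.flatten x y hx hy
  · refine Tree.root_or_split (p := fun t => Function.support (P.levelFun f n t) =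
      (P.shift n).nodeSet t.1) (fun j => ?_) (fun k i => ?_) t
    · rw [levelFun_root, nodeSet_root, shift_cell_root]
      refine Subset.antisymm support_indicator_subset fun x hx => ?_
      rw [Function.mem_support, indicator_of_mem hx]
      exact (one_div_pos.2 (Real.sqrt_pos.2 (P.cell_toReal_pos n j))).ne'
    · rw [levelFun_split, h.support_eq, nodeSet_split, nodeSet_split]
      rfl
  · rw [levelFun_root, shift_cell_root]
  · refine Tree.root_or_split (p := fun t => ∫ x, P.levelFun f n t x * P.levelFun f n t x ∂lam = 1)
      (fun j => ?_) (fun k i => ?_) t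
    · have hp := P.cell_toReal_pos n j
      rw [hmul, integral_indicator (P.measurableSet_cell _ _), integral_const_mul, levelFun_root,
        integral_indicator (P.measurableSet_cell _ _), Measure.restrict_restrict
        (P.measurableSet_cell _ _), inter_self, setIntegral_const, smul_eq_mul, Measure.real]
      have hs := Real.sq_sqrt hp.le
      have hs' := (Real.sqrt_pos.2 hp).ne'
      field_simp
      exact hs.symm
    · rw [levelFun_split]
      exact h.integral_sq _
  · revert s
    refine Tree.root_or_split (p := fun t => ∀ s, t ≠ s →
      ∫ x, P.levelFun f n t x * P.levelFun f n s x ∂lam = 0)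
      (fun j s => ?_) (fun k i s => ?_) t
    · refine Tree.root_or_split (p := fun s => Tree.root j ≠ s →
        ∫ x, P.levelFun f n (Tree.root j) x * P.levelFun f n s x ∂lam = 0)
        (fun j' hne => ?_) (fun k' i' _ => hsplit _ _ _) s
      rw [hmul, integral_indicator (P.measurableSet_cell _ _), levelFun_root]
      refine setIntegral_eq_zero_of_forall_eq_zero fun x hx => ?_
      have hx' : x ∉ P.cell n j' := fun hx' => hne (by rw [P.cell_eq_of_mem hx hx'])
      rw [indicator_of_notMem hx', mul_zero]
    · refine Tree.root_or_split (p := fun s => Tree.split i ≠ s →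
        ∫ x, P.levelFun f n (Tree.split i) x * P.levelFun f n s x ∂lam = 0)
        (fun j' _ => ?_) (fun k' i' hne => ?_) s
      · simp only [mul_comm (P.levelFun f n (Tree.split i) _)]
        exact hsplit _ _ _
      · rw [levelFun_split, levelFun_split]
        refine h.integral_mul _ _ fun e => hne ?_
        have hd : n + k + 1 = n + k' + 1 := congrArg Tree.depth e
        obtain rfl : k = k' := by omega
        rw [Label.flatten_injective (Tree.split_inj (n := n + k) e)]

end Shift

end BinaryPartitions

end TreeRep

namespace TreeRep

/-! ### Traces -/

section Trace

variable {H : Type*} [NormedAddCommGroup H] [InnerProductSpace ℂ H]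

/-- `HasTrace` speaks only of bases indexed by subsets of the space; an indexed basis is injective
and can be reindexed by its range. -/
theorem HasTrace.hasSum_inner [CompleteSpace H] {T : H →L[ℂ] H} {t : ℂ} (h : HasTrace T t)
    {ι : Type*} (b : HilbertBasis ι ℂ H) : HasSum (fun i => ⟪b i, T (b i)⟫_ℂ) t := by
  have hinj : Function.Injective b := b.orthonormal.linearIndependent.injective
  have hon : Orthonormal ℂ ((↑) : range b → H) := b.orthonormal.toSubtypeRange
  have hsp : ⊤ ≤ (Submodule.span ℂ (range ((↑) : range b → H))).topologicalClosure := by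
    rw [Subtype.range_coe]
    exact b.dense_span.ge
  have h1 := h (range b) (HilbertBasis.mk hon hsp) (HilbertBasis.coe_mk hon hsp)
  rw [HilbertBasis.coe_mk] at h1
  exact (Equiv.hasSum_iff (Equiv.ofInjective b hinj)).2 h1

/-- An operator of trace class is a Hilbert–Schmidt operator. -/
theorem IsTraceClass.summable_norm_sq [CompleteSpace H] {T : H →L[ℂ] H} (h : IsTraceClass T)
    {ι : Type*} (b : HilbertBasis ι ℂ H) : Summable fun i => ‖T (b i)‖ ^ 2 := by
  obtain ⟨t, ht⟩ := h
  -- With `A = |T|` and `R = √A` one has `‖T x‖ = ‖A x‖ ≤ ‖R‖ ‖R x‖` and `‖R x‖² = ⟪x, A x⟫`, and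
  -- the last terms are summable along a basis.
  set A := CFC.abs T with hA
  set R := CFC.sqrt A with hR
  have hRs : IsSelfAdjoint R := IsSelfAdjoint.of_nonneg (CFC.sqrt_nonneg A)
  have hAs : IsSelfAdjoint A := IsSelfAdjoint.of_nonneg (CFC.abs_nonneg T)
  have hRR : R * R = A := CFC.sqrt_mul_sqrt_self A (CFC.abs_nonneg T)
  have hAA : A * A = star T * T := CFC.abs_mul_abs T
  have hsa : ∀ {B : H →L[ℂ] H}, IsSelfAdjoint B → ∀ x y, ⟪B x, y⟫_ℂ = ⟪x, B y⟫_ℂ := by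
    intro B hB x y
    conv_lhs => rw [← hB.star_eq, ContinuousLinearMap.star_eq_adjoint]
    exact ContinuousLinearMap.adjoint_inner_left B y x
  have h1 : ∀ x, ‖T x‖ ^ 2 = ‖A x‖ ^ 2 := by
    intro x
    have e : ⟪T x, T x⟫_ℂ = ⟪A x, A x⟫_ℂ := by
      rw [hsa hAs, ← ContinuousLinearMap.adjoint_inner_right, ← ContinuousLinearMap.star_eq_adjoint]
      change ⟪x, (star T * T) x⟫_ℂ = ⟪x, (A * A) x⟫_ℂ
      rw [hAA]
    rw [inner_self_eq_norm_sq_to_K, inner_self_eq_norm_sq_to_K] at e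
    exact_mod_cast e
  have h2 : ∀ x, ⟪x, A x⟫_ℂ = ((‖R x‖ ^ 2 : ℝ) : ℂ) := by
    intro x
    rw [← hRR]
    change ⟪x, R (R x)⟫_ℂ = _
    rw [← hsa hRs, inner_self_eq_norm_sq_to_K]
    norm_cast
  have h3 : Summable fun i => ‖R (b i)‖ ^ 2 := by
    have := (ht.hasSum_inner b).summable
    simp only [h2] at this
    exact Complex.summable_ofReal.1 this
  refine Summable.of_nonneg_of_le (fun i => by positivity) (fun i => ?_) (h3.mul_left (‖R‖ ^ 2))
  rw [h1, ← hRR, ← mul_pow]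
  exact pow_le_pow_left₀ (norm_nonneg _) (R.le_opNorm _) 2

end Trace

theorem eLpNorm_two_sq {X : Type*} [MeasurableSpace X] (μ : Measure X) (g : X → ℂ) :
    eLpNorm g 2 μ ^ 2 = ∫⁻ x, ‖g x‖ₑ ^ 2 ∂μ := by
  rw [eLpNorm_eq_lintegral_rpow_enorm_toReal (by norm_num) (by norm_num),
    ← ENNReal.rpow_natCast, ← ENNReal.rpow_mul]
  norm_num

theorem enorm_sq_eq_lintegral {X : Type*} [MeasurableSpace X] {μ : Measure X} (v : Lp ℂ 2 μ) :
    ‖v‖ₑ ^ 2 = ∫⁻ x, ‖v x‖ₑ ^ 2 ∂μ := by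
  rw [Lp.enorm_def, eLpNorm_two_sq]

/-! ### Haar systems as Hilbert bases of `L²(lam)` -/

namespace BinaryPartitions

namespace IsHaarSystem

section Basis

variable {S J : Type*} [TopologicalSpace S] [MeasurableSpace S] {lam : Measure S}
  {P : BinaryPartitions lam J} {e : Tree J → S → ℝ}

open Classical in
theorem integral_mul_ofReal (h : P.IsHaarSystem e) (t s : Tree J) :
    ∫ x, (e t x : ℂ) * (e s x : ℂ) ∂lam = if t = s then 1 else 0 := by
  simp only [← Complex.ofReal_mul]
  rw [integral_complex_ofReal]
  split_ifs with hts
  · rw [hts, h.integral_sq, Complex.ofReal_one]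
  · rw [h.integral_mul t s hts, Complex.ofReal_zero]

variable [IsFiniteMeasureOnCompacts lam]

/-- A function of a Haar system as an element of `L²`. -/
noncomputable def vec (h : P.IsHaarSystem e) (t : Tree J) : Lp ℂ 2 lam := (h.memLp t 2).toLp _

theorem coeFn_vec (h : P.IsHaarSystem e) (t : Tree J) :
    h.vec t =ᵐ[lam] fun x => (e t x : ℂ) :=
  MemLp.coeFn_toLp _

theorem inner_vec (h : P.IsHaarSystem e) (t : Tree J) (g : Lp ℂ 2 lam) :
    ⟪h.vec t, g⟫_ℂ = ∫ x, (e t x : ℂ) * g x ∂lam := by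
  rw [L2.inner_def]
  refine integral_congr_ae ?_
  filter_upwards [h.coeFn_vec t] with x hx
  rw [hx]
  simp [mul_comm]

theorem orthonormal_vec (h : P.IsHaarSystem e) : Orthonormal ℂ h.vec := by
  classical
  refine orthonormal_iff_ite.2 fun t s => ?_
  rw [h.inner_vec, ← h.integral_mul_ofReal]
  refine integral_congr_ae ?_
  filter_upwards [h.coeFn_vec s] with x hx
  rw [hx]

theorem _root_.TreeRep.BinaryPartitions.integrableOn_cell_of_memLp {P : BinaryPartitions lam J}
    {g : S → ℂ} (hg : MemLp g 2 lam) {k : ℕ} (i : Label J k) : IntegrableOn g (P.cell k i) lam := by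
  have : IsFiniteMeasure (lam.restrict (P.cell k i)) :=
    ⟨by simpa using (P.cell_ne_top _ _).lt_top⟩
  exact (hg.restrict _).integrable (by norm_num)

variable [BorelSpace S] [Countable J]

/-- A Haar system as a Hilbert basis. -/
noncomputable def basis (h : P.IsHaarSystem e) : HilbertBasis (Tree J) ℂ (Lp ℂ 2 lam) :=
  HilbertBasis.mkOfOrthogonalEqBot h.orthonormal_vec (by
    rw [Submodule.eq_bot_iff]
    intro g hg
    rw [Submodule.mem_orthogonal] at hg
    have h0 : g =ᵐ[lam] 0 := h.ae_eq_zero (fun j => integrableOn_cell_of_memLp (Lp.memLp g) _)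
      fun t => by
        rw [← h.inner_vec]
        exact hg _ (Submodule.subset_span ⟨t, rfl⟩)
    exact (Lp.eq_zero_iff_ae_eq_zero).2 h0)

theorem coe_basis (h : P.IsHaarSystem e) : ⇑h.basis = h.vec :=
  HilbertBasis.coe_mkOfOrthogonalEqBot _ _

/-- An integrable function with square summable coefficients is square integrable. -/
theorem lintegral_sq_le (h : P.IsHaarSystem e) {g : S → ℂ} (hg : Integrable g lam) :
    ∫⁻ x, ‖g x‖ₑ ^ 2 ∂lam ≤ ∑' t, ‖∫ x, (e t x : ℂ) * g x ∂lam‖ₑ ^ 2 := by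
  set c : Tree J → ℂ := fun t => ∫ x, (e t x : ℂ) * g x ∂lam with hc
  by_cases htop : ∑' t, ‖c t‖ₑ ^ 2 = ∞
  · rw [htop]; exact le_top
  have hsum : Summable fun t => ‖c t‖ ^ (2 : ℝ≥0∞).toReal := by
    have h1 : ∑' t, ENNReal.ofReal (‖c t‖ ^ 2) ≠ ∞ := by
      simpa only [ENNReal.ofReal_pow (norm_nonneg _), ofReal_norm] using htop
    have h2 := ENNReal.summable_toReal h1
    simp only [ENNReal.toReal_ofReal (sq_nonneg _)] at h2
    simpa using h2
  set u : lp (fun _ : Tree J => ℂ) 2 := ⟨c, memℓp_gen hsum⟩ with hu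
  -- Riesz–Fischer: `v` is the element of `L²` with the coefficients of `g`. Since `g - v` is
  -- integrable on cells and orthogonal to the system, completeness gives `g = v` almost everywhere.
  set v : Lp ℂ 2 lam := h.basis.repr.symm u with hv
  have hin : ∀ t, ∫ x, (e t x : ℂ) * v x ∂lam = c t := by
    intro t
    rw [← h.inner_vec, ← h.coe_basis, ← h.basis.repr_apply_apply, hv,
      LinearIsometryEquiv.apply_symm_apply]
  have hae : (fun x => g x - v x) =ᵐ[lam] 0 := by
    have hi : ∀ j, IntegrableOn v (P.cell 0 (Label.root j)) lam := fun j =>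
      integrableOn_cell_of_memLp (Lp.memLp v) _
    refine h.ae_eq_zero (fun j => hg.integrableOn.sub (hi j)) fun t => ?_
    simp only [mul_sub]
    rw [integral_sub (h.integrable_mul t hg.integrableOn) (h.integrable_mul t (hi _)), hin]
    exact sub_self _
  have h3 : ∫⁻ x, ‖g x‖ₑ ^ 2 ∂lam = ‖v‖ₑ ^ 2 := by
    rw [enorm_sq_eq_lintegral]
    refine lintegral_congr_ae ?_
    filter_upwards [hae] with x hx
    rw [sub_eq_zero.1 hx]
  have h4 : ‖v‖ ^ 2 = ∑' t, ‖c t‖ ^ 2 := by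
    rw [hv, LinearIsometryEquiv.norm_map]
    have := lp.norm_rpow_eq_tsum (p := 2) (by norm_num) u
    simpa using this
  rw [h3, ← ofReal_norm, ← ENNReal.ofReal_pow (norm_nonneg _), h4,
    ENNReal.ofReal_tsum_of_nonneg (fun t => by positivity) (by simpa using hsum)]
  simp only [ENNReal.ofReal_pow (norm_nonneg _), ofReal_norm]
  exact le_rfl

end Basis

end IsHaarSystem

end BinaryPartitions

end TreeRep

/-! ### Tensor products of Haar systems and square integrable kernels -/

namespace TreeRep

theorem memLp_two_mul_prod {X Y : Type*} [MeasurableSpace X] [MeasurableSpace Y] {μ : Measure X}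
    {ν : Measure Y} [SFinite μ] [SFinite ν] {a : X → ℂ} {b : Y → ℂ} (ha : MemLp a 2 μ)
    (hb : MemLp b 2 ν) : MemLp (fun z : X × Y => a z.1 * b z.2) 2 (μ.prod ν) := by
  have hm : AEStronglyMeasurable (fun z : X × Y => a z.1 * b z.2) (μ.prod ν) :=
    ha.1.comp_fst.mul hb.1.comp_snd
  rw [memLp_two_iff_integrable_sq_norm hm]
  simp only [norm_mul, mul_pow]
  exact ((memLp_two_iff_integrable_sq_norm ha.1).1 ha).mul_prod
    ((memLp_two_iff_integrable_sq_norm hb.1).1 hb)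

namespace BinaryPartitions

namespace IsHaarSystem

section Product

variable {S J : Type*} [TopologicalSpace S] [MeasurableSpace S] {lam : Measure S}
  [IsFiniteMeasureOnCompacts lam] [SigmaFinite lam]
  {P : BinaryPartitions lam J} {e : Tree J → S → ℝ}

theorem memLp_mul (h : P.IsHaarSystem e) (t s : Tree J) :
    MemLp (fun z : S × S => (e t z.1 : ℂ) * (e s z.2 : ℂ)) 2 (lam.prod lam) :=
  memLp_two_mul_prod (h.memLp t 2) (h.memLp s 2)

theorem integrable_mul_mul (h : P.IsHaarSystem e) {g : S × S → ℂ} (hg : MemLp g 2 (lam.prod lam))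
    (t s : Tree J) :
    Integrable (fun z : S × S => (e t z.1 : ℂ) * (e s z.2 : ℂ) * g z) (lam.prod lam) :=
  (h.memLp_mul t s).integrable_mul hg

/-- The product of two functions of a Haar system as an element of `L²` of the product. -/
noncomputable def vec₂ (h : P.IsHaarSystem e) (q : Tree J × Tree J) : Lp ℂ 2 (lam.prod lam) :=
  (h.memLp_mul q.1 q.2).toLp _

theorem coeFn_vec₂ (h : P.IsHaarSystem e) (q : Tree J × Tree J) :
    h.vec₂ q =ᵐ[lam.prod lam] fun z => (e q.1 z.1 : ℂ) * (e q.2 z.2 : ℂ) :=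
  MemLp.coeFn_toLp _

theorem inner_vec₂ (h : P.IsHaarSystem e) (q : Tree J × Tree J) (g : Lp ℂ 2 (lam.prod lam)) :
    ⟪h.vec₂ q, g⟫_ℂ = ∫ z, (e q.1 z.1 : ℂ) * (e q.2 z.2 : ℂ) * g z ∂(lam.prod lam) := by
  rw [L2.inner_def]
  refine integral_congr_ae ?_
  filter_upwards [h.coeFn_vec₂ q] with x hx
  rw [hx]
  simp [mul_comm]

theorem orthonormal_vec₂ (h : P.IsHaarSystem e) : Orthonormal ℂ h.vec₂ := by
  classical
  refine orthonormal_iff_ite.2 fun q r => ?_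
  have h1 : ⟪h.vec₂ q, h.vec₂ r⟫_ℂ = ∫ z : S × S, ((e q.1 z.1 : ℂ) * (e r.1 z.1 : ℂ)) *
      ((e q.2 z.2 : ℂ) * (e r.2 z.2 : ℂ)) ∂(lam.prod lam) := by
    rw [h.inner_vec₂]
    refine integral_congr_ae ?_
    filter_upwards [h.coeFn_vec₂ r] with x hx
    rw [hx]
    ring
  rw [h1, integral_prod_mul (fun x => (e q.1 x : ℂ) * (e r.1 x : ℂ))
    (fun x => (e q.2 x : ℂ) * (e r.2 x : ℂ)), h.integral_mul_ofReal, h.integral_mul_ofReal]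
  by_cases h1 : q.1 = r.1 <;> by_cases h2 : q.2 = r.2 <;> simp [h1, h2, Prod.ext_iff]

variable [BorelSpace S] [Countable J]

/-- Completeness is used once in each variable: first for `x ↦ ∫ y, e s y * g (x, y)` with `s`
fixed, then, for almost every `x` and all of the countably many `s`, for the slice `g (x, ·)`. -/
theorem ae_eq_zero_prod (h : P.IsHaarSystem e) {g : S × S → ℂ} (hm : StronglyMeasurable g)
    (hg : MemLp g 2 (lam.prod lam))
    (hz : ∀ t s, ∫ z, (e t z.1 : ℂ) * (e s z.2 : ℂ) * g z ∂(lam.prod lam) = 0) :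
    g =ᵐ[lam.prod lam] 0 := by
  have hu : ∀ s : Tree J, (fun x => ∫ y, (e s y : ℂ) * g (x, y) ∂lam) =ᵐ[lam] 0 := by
    intro s
    refine h.ae_eq_zero (fun j => ?_) fun t => ?_
    -- Pairing `g` with the square integrable function `1_A ⊗ e s` gives integrability over the cell
    -- `A`.
    · generalize hAj : P.cell 0 (Label.root j) = A
      have hAm : MeasurableSet A := hAj ▸ P.measurableSet_cell _ _
      have hAt : lam A ≠ ∞ := hAj ▸ P.cell_ne_top _ _
      have hA : MemLp (A.indicator fun _ => (1 : ℂ)) 2 lam :=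
        memLp_indicator_const 2 hAm 1 (Or.inr hAt)
      have h1 := ((memLp_two_mul_prod hA (h.memLp s 2)).integrable_mul hg).integral_prod_left
      rw [← integrable_indicator_iff hAm]
      refine h1.congr (Filter.Eventually.of_forall fun x => ?_)
      by_cases hx : x ∈ A <;> simp [hx]
    · rw [← hz t s, integral_prod _ (h.integrable_mul_mul hg t s)]
      congr 1
      funext x
      rw [← integral_const_mul]
      simp only [mul_assoc]
  have h2 := ((memLp_two_iff_integrable_sq_norm hg.1).1 hg).prod_right_ae
  have hset : MeasurableSet {z : S × S | g z = 0} := hm.measurable (measurableSet_singleton 0)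
  refine (Measure.ae_prod_mem_iff_ae_ae_mem hset).2 ?_
  filter_upwards [h2, ae_all_iff.2 hu] with x hx hx'
  have hx2 : MemLp (fun y => g (x, y)) 2 lam :=
    (memLp_two_iff_integrable_sq_norm
      (hm.comp_measurable measurable_prodMk_left).aestronglyMeasurable).2 hx
  exact h.ae_eq_zero (fun j => integrableOn_cell_of_memLp hx2 _) hx'

/-- The products of the functions of a Haar system as a Hilbert basis. -/
noncomputable def basis₂ (h : P.IsHaarSystem e) :
    HilbertBasis (Tree J × Tree J) ℂ (Lp ℂ 2 (lam.prod lam)) :=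
  HilbertBasis.mkOfOrthogonalEqBot h.orthonormal_vec₂ (by
    rw [Submodule.eq_bot_iff]
    intro g hg
    rw [Submodule.mem_orthogonal] at hg
    have h0 : g =ᵐ[lam.prod lam] 0 :=
      h.ae_eq_zero_prod (Lp.stronglyMeasurable g) (Lp.memLp g) fun t s => by
        rw [← h.inner_vec₂ (t, s)]
        exact hg _ (Submodule.subset_span ⟨(t, s), rfl⟩)
    exact (Lp.eq_zero_iff_ae_eq_zero).2 h0)

theorem coe_basis₂ (h : P.IsHaarSystem e) : ⇑h.basis₂ = h.vec₂ :=
  HilbertBasis.coe_mkOfOrthogonalEqBot _ _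

/-- The kernel of a Hilbert–Schmidt operator is square integrable. -/
theorem memLp_kernel (h : P.IsHaarSystem e) {k : S → S → ℂ}
    (hk : Measurable fun z : S × S => k z.1 z.2) {C : Set S} {T : Lp ℂ 2 lam →L[ℂ] Lp ℂ 2 lam}
    (hT : IsIntegralOperator lam (cutKernel C k) T)
    (hs : Summable fun t => ‖T (h.vec t)‖ ^ 2) {i j : J}
    (hi : P.cell 0 (Label.root i) ⊆ C) (hj : P.cell 0 (Label.root j) ⊆ C) :
    MemLp ((P.cell 0 (Label.root i) ×ˢ P.cell 0 (Label.root j)).indicator fun z => k z.1 z.2) 2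
      (lam.prod lam) := by
  set A := P.cell 0 (Label.root i)
  set B := P.cell 0 (Label.root j)
  have hA : MeasurableSet A := P.measurableSet_cell _ _
  have hB : MeasurableSet B := P.measurableSet_cell _ _
  have hm := hk.indicator (hA.prod hB)
  refine ⟨hm.aestronglyMeasurable, ?_⟩
  have hfin : ∑' t, ‖T (h.vec t)‖ₑ ^ 2 < ∞ := by
    have := hs.tsum_ofReal_lt_top
    simpa only [ENNReal.ofReal_pow (norm_nonneg _), ofReal_norm] using this
  have hle : ∫⁻ z, ‖(A ×ˢ B).indicator (fun z => k z.1 z.2) z‖ₑ ^ 2 ∂(lam.prod lam) ≤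
      ∑' t, ‖T (h.vec t)‖ₑ ^ 2 := by
    -- By Tonelli it suffices to bound, for almost every `x`, the `L²` norm of the row `k x` on `B`.
    -- The coefficients of this row are the values at `x` of the functions `T (h.vec t)`.
    rw [lintegral_prod _ (hm.enorm.pow_const 2).aemeasurable]
    simp only [enorm_sq_eq_lintegral]
    rw [← lintegral_tsum fun t =>
      ((Lp.stronglyMeasurable (T (h.vec t))).measurable.enorm.pow_const 2).aemeasurable]
    refine lintegral_mono_ae ?_
    filter_upwards [ae_all_iff.2 fun t => hT (h.vec t)] with x hx
    by_cases hxA : x ∈ A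
    swap
    · simp [hxA]
    have hg : ∀ y, (A ×ˢ B).indicator (fun z => k z.1 z.2) (x, y) = B.indicator (k x) y := by
      intro y
      by_cases hy : y ∈ B <;> simp [hxA, hy]
    simp only [hg]
    have hcut : ∀ y ∈ B, cutKernel C k x y = k x y := fun y hy =>
      indicator_of_mem (s := C ×ˢ C) (show (x, y) ∈ C ×ˢ C from ⟨hi hxA, hj hy⟩) _
    -- The root function is a non-zero constant on `B` and vanishes elsewhere, and its product with
    -- the row is integrable because `T` is an integral operator.
    have hint : Integrable (B.indicator (k x)) lam := by
      have h1 := (hx (Tree.root j)).1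
      have hc : ((1 / √(lam B).toReal : ℝ) : ℂ) ≠ 0 := by
        exact_mod_cast (one_div_pos.2 (Real.sqrt_pos.2 (P.cell_toReal_pos _ _))).ne'
      refine (h1.const_mul (((1 / √(lam B).toReal : ℝ) : ℂ)⁻¹)).congr ?_
      filter_upwards [h.coeFn_vec (Tree.root j)] with y hy
      rw [hy, h.root_eq]
      by_cases hyB : y ∈ B
      · rw [indicator_of_mem hyB, indicator_of_mem hyB, hcut y hyB, mul_comm (k x y),
          inv_mul_cancel_left₀ hc]
      · rw [indicator_of_notMem hyB, indicator_of_notMem hyB]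
        simp
    refine (h.lintegral_sq_le hint).trans (ENNReal.tsum_le_tsum fun t => ?_)
    -- Nodes over other roots may contribute to `T`, whose kernel is cut to the larger set `C`, but
    -- not to the row on `B`; an inequality is enough.
    by_cases ht : t.base = j
    · rw [(hx t).2]
      refine le_of_eq ?_
      congr 2
      refine integral_congr_ae ?_
      filter_upwards [h.coeFn_vec t] with y hy
      rw [hy, mul_comm]
      by_cases hyB : y ∈ B
      · rw [indicator_of_mem hyB, hcut y hyB]
      · rw [h.eq_zero (by rwa [ht])]
        simp
    · have h0 : ∀ y, (e t y : ℂ) * B.indicator (k x) y = 0 := by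
        intro y
        by_cases hyB : y ∈ B
        · rw [h.eq_zero fun hy => ht (congrArg Prod.fst (P.cell_eq_of_mem hy hyB))]
          simp
        · simp [hyB]
      simp [h0]
  have h2 := hle.trans_lt hfin
  rw [← eLpNorm_two_sq] at h2
  exact (ENNReal.pow_lt_top_iff.1 h2).resolve_right two_ne_zero

end Product

end IsHaarSystem

end BinaryPartitions

end TreeRep

namespace TreeRep

/-! ### Integrals of products along the cycles of a permutation -/

section Cycles

open Filter Topology

variable {ι X : Type*}

theorem measurable_comp_pair [MeasurableSpace X] {Y : Type*} [MeasurableSpace Y] {f : X × X → Y} (hf : Measurable f)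
    (p q : ι) : Measurable fun x : ι → X => f (x p, x q) :=
  hf.comp ((measurable_pi_apply p).prodMk (measurable_pi_apply q))

/-- The permutation induced on the points that are not fixed. -/
def movedPerm (σ : Equiv.Perm ι) : Equiv.Perm {p // ¬ σ p = p} :=
  σ.subtypePerm fun _ => not_congr σ.apply_eq_iff_eq

theorem movedPerm_ne (σ : Equiv.Perm ι) (p : {p // ¬ σ p = p}) : movedPerm σ p ≠ p :=
  fun h => p.2 (congrArg Subtype.val h)

theorem prod_perm_eq {Y : Type*} [Fintype ι] [DecidableEq ι] (σ : Equiv.Perm ι) (f : ι → Y × Y → ℂ) (x : ι → Y) :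
    ∏ p, f p (x p, x (σ p)) =
      (∏ p : {p // σ p = p}, f p (x p, x p)) *
        ∏ p : {p // ¬ σ p = p}, f p (x p, x (movedPerm σ p)) := by
  rw [← Fintype.prod_subtype_mul_prod_subtype (fun p => σ p = p)]
  congr 1
  exact Finset.prod_congr rfl fun p _ => by rw [p.2]

variable [Fintype ι] [DecidableEq ι] [MeasurableSpace X] {μ : Measure X} [SigmaFinite μ]

/-- Induction on the set `s` of variables integrated out. A new variable `q` occurs only in the
factors with index `q` and `τ⁻¹ q`, which are distinct as `τ` has no fixed point. Cauchy–Schwarz in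
`q` moves the integration into these two factors and leaves the others unchanged. -/
theorem lmarginal_prod_pair_le {τ : Equiv.Perm ι} (hτ : ∀ p, τ p ≠ p) {H : ι → X × X → ℝ≥0∞}
    (hH : ∀ p, Measurable (H p)) (s : Finset ι) (x : ι → X) :
    lmarginal (fun _ => μ) s (fun x => ∏ p, H p (x p, x (τ p))) x ≤
      ∏ p, (lmarginal (fun _ => μ) (s ∩ {p, τ p}) (fun x => H p (x p, x (τ p)) ^ 2) x) ^
        (1 / 2 : ℝ) := by
  set F : ι → (ι → X) → ℝ≥0∞ := fun p x => H p (x p, x (τ p)) ^ 2 with hF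
  have hFm : ∀ p, Measurable (F p) := fun p =>
    (measurable_comp_pair (hH p) p (τ p)).pow_const 2
  set G : ι → Finset ι → (ι → X) → ℝ≥0∞ := fun p s => lmarginal (fun _ => μ) s (F p) with hG
  have hGm : ∀ p s, Measurable (G p s) := fun p s => (hFm p).lmarginal _
  induction s using Finset.induction_on generalizing x with
  | empty =>
    simp only [lmarginal_empty, Finset.empty_inter]
    refine le_of_eq (Finset.prod_congr rfl fun p _ => ?_)
    rw [← ENNReal.rpow_natCast, ← ENNReal.rpow_mul]
    norm_num
  | insert q s hq ih =>
    rw [lmarginal_insert _ (Finset.measurable_prod _ fun p _ =>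
      measurable_comp_pair (hH p) p (τ p)) hq]
    set r := τ.symm q with hr
    have hrq : r ≠ q := fun h => hτ r (by rw [hr, Equiv.apply_symm_apply, ← hr, h])
    have hτr : τ r = q := τ.apply_symm_apply q
    have hout : ∀ p ∈ (Finset.univ.erase q).erase r, ∀ y,
        G p (s ∩ {p, τ p}) (Function.update x q y) = G p ((insert q s) ∩ {p, τ p}) x := by
      intro p hp y
      simp only [Finset.mem_erase, Finset.mem_univ, and_true] at hp
      have h1 : q ≠ p := fun h => hp.2 h.symm
      have h2 : q ≠ τ p := fun h => hp.1 (by rw [hr, h, Equiv.symm_apply_apply])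
      have h3 : q ∉ s ∩ {p, τ p} := by simp [h1, h2]
      rw [Finset.insert_inter_of_notMem (by simp [h1, h2])]
      simp only [hG]
      rw [lmarginal_update_of_notMem (hFm p) h3]
      congr 1
      funext z
      simp [hF, Function.comp, Function.update_of_ne h1.symm, Function.update_of_ne h2.symm]
    have hins : ∀ p, q ∈ ({p, τ p} : Finset ι) →
        ∫⁻ y, G p (s ∩ {p, τ p}) (Function.update x q y) ∂μ = G p ((insert q s) ∩ {p, τ p}) x := by
      intro p hp
      rw [Finset.insert_inter_of_mem hp]
      simp only [hG]
      rw [lmarginal_insert _ (hFm p) (fun h => hq (Finset.mem_of_mem_inter_left h))]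
    have hsplit : ∀ g : ι → ℝ≥0∞,
        ∏ p, g p = (∏ p ∈ (Finset.univ.erase q).erase r, g p) * (g r * g q) := by
      intro g
      rw [← mul_assoc, Finset.prod_erase_mul _ _ (by simp [hrq]),
        Finset.prod_erase_mul _ _ (Finset.mem_univ q)]
    have hupd : Measurable fun y : X => Function.update x q y := measurable_update x
    calc _ ≤ ∫⁻ y, ∏ p, (G p (s ∩ {p, τ p}) (Function.update x q y)) ^ (1 / 2 : ℝ) ∂μ :=
          lintegral_mono fun y => ih _
      _ = ∫⁻ y, (∏ p ∈ (Finset.univ.erase q).erase r,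
            (G p ((insert q s) ∩ {p, τ p}) x) ^ (1 / 2 : ℝ)) *
            ((G r (s ∩ {r, τ r}) (Function.update x q y)) ^ (1 / 2 : ℝ) *
            (G q (s ∩ {q, τ q}) (Function.update x q y)) ^ (1 / 2 : ℝ)) ∂μ := by
          refine lintegral_congr fun y => ?_
          rw [hsplit]
          congr 1
          exact Finset.prod_congr rfl fun p hp => by rw [hout p hp y]
      _ = (∏ p ∈ (Finset.univ.erase q).erase r,
            (G p ((insert q s) ∩ {p, τ p}) x) ^ (1 / 2 : ℝ)) *
            ∫⁻ y, (G r (s ∩ {r, τ r}) (Function.update x q y)) ^ (1 / 2 : ℝ) *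
            (G q (s ∩ {q, τ q}) (Function.update x q y)) ^ (1 / 2 : ℝ) ∂μ :=
          lintegral_const_mul _ ((((hGm _ _).comp hupd).pow_const _).mul
            (((hGm _ _).comp hupd).pow_const _))
      _ ≤ (∏ p ∈ (Finset.univ.erase q).erase r,
            (G p ((insert q s) ∩ {p, τ p}) x) ^ (1 / 2 : ℝ)) *
            ((G r ((insert q s) ∩ {r, τ r}) x) ^ (1 / 2 : ℝ) *
            (G q ((insert q s) ∩ {q, τ q}) x) ^ (1 / 2 : ℝ)) := by
          gcongr
          refine (ENNReal.lintegral_mul_le_Lp_mul_Lq μ Real.HolderConjugate.two_two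
            (((hGm _ _).comp hupd).pow_const _).aemeasurable
            (((hGm _ _).comp hupd).pow_const _).aemeasurable).trans (le_of_eq ?_)
          simp only [← ENNReal.rpow_mul, one_div_mul_cancel (two_ne_zero' ℝ), ENNReal.rpow_one,
            Function.comp_apply]
          rw [hins r (by simp [hτr]), hins q (by simp)]
      _ = _ := (hsplit _).symm

/-- Finner's inequality for cycles: every variable occurs in two factors. -/
theorem lintegral_prod_pair_le {τ : Equiv.Perm ι} (hτ : ∀ p, τ p ≠ p) {H : ι → X × X → ℝ≥0∞}
    (hH : ∀ p, Measurable (H p)) :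
    ∫⁻ x, ∏ p, H p (x p, x (τ p)) ∂Measure.pi (fun _ => μ) ≤
      ∏ p, (∫⁻ z, H p z ^ 2 ∂μ.prod μ) ^ (1 / 2 : ℝ) := by
  -- A base point is needed to write the integral as a marginal over all variables; its choice is
  -- irrelevant.
  rcases isEmpty_or_nonempty (ι → X) with hem | ⟨⟨x⟩⟩
  · rw [lintegral_of_isEmpty]; exact zero_le
  rw [lintegral_eq_lmarginal_univ x]
  refine (lmarginal_prod_pair_le hτ hH _ x).trans (le_of_eq ?_)
  refine Finset.prod_congr rfl fun p _ => ?_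
  have hm := (measurable_comp_pair (hH p) p (τ p)).pow_const 2
  rw [Finset.univ_inter, lmarginal_insert _ hm (by simp [(hτ p).symm]), lmarginal_singleton,
    lintegral_prod _ ((hH p).pow_const 2).aemeasurable]
  simp [Function.update_of_ne (hτ p).symm]

theorem lintegral_enorm_prod_pair_le {τ : Equiv.Perm ι} (hτ : ∀ p, τ p ≠ p) {f : ι → X × X → ℂ}
    (hf : ∀ p, Measurable (f p)) :
    ∫⁻ x, ‖∏ p, f p (x p, x (τ p))‖ₑ ∂Measure.pi (fun _ => μ) ≤
      ∏ p, eLpNorm (f p) 2 (μ.prod μ) := by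
  have he : ∀ x : ι → X, ‖∏ p, f p (x p, x (τ p))‖ₑ = ∏ p, ‖f p (x p, x (τ p))‖ₑ := fun x => by
    simp [enorm, nnnorm_prod]
  simp only [he]
  refine (lintegral_prod_pair_le hτ fun p => (hf p).enorm).trans (le_of_eq ?_)
  refine Finset.prod_congr rfl fun p _ => ?_
  rw [← eLpNorm_two_sq, ← ENNReal.rpow_natCast, ← ENNReal.rpow_mul]
  norm_num

theorem integrable_prod_pair {τ : Equiv.Perm ι} (hτ : ∀ p, τ p ≠ p) {f : ι → X × X → ℂ}
    (hf : ∀ p, Measurable (f p)) (h2 : ∀ p, MemLp (f p) 2 (μ.prod μ)) :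
    Integrable (fun x : ι → X => ∏ p, f p (x p, x (τ p))) (Measure.pi fun _ => μ) :=
  ⟨(Finset.measurable_prod _ fun p _ => measurable_comp_pair (hf p) p (τ p)).aestronglyMeasurable,
    (lintegral_enorm_prod_pair_le hτ hf).trans_lt
      (ENNReal.prod_lt_top fun p _ => (h2 p).eLpNorm_lt_top)⟩

/-- Write `u = (u - v) + v` in each factor and expand. Every term other than the pure product of the
`v p` contains a factor `u n p - v p` tending to zero in `L²`, and is bounded by the product of the
`L²` norms of its factors. -/
theorem tendsto_integral_prod_pair {τ : Equiv.Perm ι} (hτ : ∀ p, τ p ≠ p) {β : Type*} {l : Filter β}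
    {u : β → ι → X × X → ℂ} {v : ι → X × X → ℂ}
    (hu : ∀ n p, Measurable (u n p)) (hv : ∀ p, Measurable (v p))
    (hu2 : ∀ n p, MemLp (u n p) 2 (μ.prod μ)) (hv2 : ∀ p, MemLp (v p) 2 (μ.prod μ))
    (h : ∀ p, Tendsto (fun n => eLpNorm (u n p - v p) 2 (μ.prod μ)) l (𝓝 0)) :
    Tendsto (fun n => ∫ x, ∏ p, u n p (x p, x (τ p)) ∂Measure.pi fun _ => μ) l
      (𝓝 (∫ x, ∏ p, v p (x p, x (τ p)) ∂Measure.pi fun _ => μ)) := by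
  set w : β → Finset ι → ι → X × X → ℂ := fun n t => t.piecewise (u n - v) v with hw
  have hwm : ∀ n t p, Measurable (w n t p) := fun n t p => by
    by_cases hp : p ∈ t
    · simp only [hw, Finset.piecewise_eq_of_mem _ _ _ hp]; exact (hu n p).sub (hv p)
    · simp only [hw, Finset.piecewise_eq_of_notMem _ _ _ hp]; exact hv p
  have hw2 : ∀ n t p, MemLp (w n t p) 2 (μ.prod μ) := fun n t p => by
    by_cases hp : p ∈ t
    · simp only [hw, Finset.piecewise_eq_of_mem _ _ _ hp]; exact (hu2 n p).sub (hv2 p)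
    · simp only [hw, Finset.piecewise_eq_of_notMem _ _ _ hp]; exact hv2 p
  have hsum : ∀ n, ∫ x, ∏ p, u n p (x p, x (τ p)) ∂(Measure.pi fun _ => μ) =
      ∑ t : Finset ι, ∫ x, ∏ p, w n t p (x p, x (τ p)) ∂Measure.pi fun _ => μ := by
    intro n
    rw [← integral_finsetSum _ fun t _ => integrable_prod_pair hτ (hwm n t) (hw2 n t)]
    congr 1
    funext x
    have h1 := Finset.prod_add (fun p => (u n - v) p (x p, x (τ p)))
      (fun p => v p (x p, x (τ p))) Finset.univ
    simp only [Pi.sub_apply, sub_add_cancel, Finset.powerset_univ] at h1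
    rw [h1]
    refine Finset.sum_congr rfl fun t _ => ?_
    rw [← Finset.prod_mul_prod_compl t, Finset.compl_eq_univ_sdiff]
    congr 1
    · exact Finset.prod_congr rfl fun p hp => by
        simp only [hw, Finset.piecewise_eq_of_mem _ _ _ hp, Pi.sub_apply]
    · exact Finset.prod_congr rfl fun p hp => by
        simp only [hw, Finset.piecewise_eq_of_notMem _ _ _ (Finset.mem_sdiff.1 hp).2]
  have hlim : ∀ t : Finset ι, Tendsto
      (fun n => ∫ x, ∏ p, w n t p (x p, x (τ p)) ∂Measure.pi fun _ => μ) l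
      (𝓝 (if t = ∅ then ∫ x, ∏ p, v p (x p, x (τ p)) ∂Measure.pi fun _ => μ else 0)) := by
    intro t
    split_ifs with ht
    · subst ht
      simp only [hw, Finset.piecewise_empty]
      exact tendsto_const_nhds
    · obtain ⟨q, hq⟩ := Finset.nonempty_iff_ne_empty.2 ht
      rw [tendsto_zero_iff_enorm_tendsto_zero]
      refine tendsto_of_tendsto_of_tendsto_of_le_of_le tendsto_const_nhds ?_
        (fun n => zero_le) fun n => (enorm_integral_le_lintegral_enorm _).trans
        (lintegral_enorm_prod_pair_le hτ (hwm n t))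
      have h0 : (0 : ℝ≥0∞) = ∏ p, if p ∈ t then 0 else eLpNorm (v p) 2 (μ.prod μ) := by
        rw [Finset.prod_eq_zero (Finset.mem_univ q)]
        exact if_pos hq
      rw [h0]
      refine ENNReal.tendsto_finsetProd_of_ne_top _ (fun p _ => ?_) fun p _ => ?_
      · split_ifs with hp
        · simp only [hw, Finset.piecewise_eq_of_mem _ _ _ hp]
          exact h p
        · simp only [hw, Finset.piecewise_eq_of_notMem _ _ _ hp]
          exact tendsto_const_nhds
      · split_ifs
        · exact ENNReal.zero_ne_top
        · exact (hv2 p).eLpNorm_ne_top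
  simp only [hsum]
  have h3 := tendsto_finsetSum Finset.univ fun t _ => hlim t
  simpa using h3

/-- Fubini separates the fixed points, which involve only the diagonal, from the moved points, where
the `L²` estimates apply. -/
theorem integral_prod_perm (σ : Equiv.Perm ι) (f : ι → X × X → ℂ) :
    ∫ x, ∏ p, f p (x p, x (σ p)) ∂(Measure.pi fun _ => μ) =
      (∏ p : {p // σ p = p}, ∫ x, f p (x, x) ∂μ) *
        ∫ y, ∏ p : {p // ¬ σ p = p}, f p (y p, y (movedPerm σ p)) ∂(Measure.pi fun _ => μ) := by
  rw [← integral_fintype_prod_eq_prod (fun (p : {p // σ p = p}) (x : X) => f p (x, x)),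
    ← integral_prod_mul]
  rw [← (measurePreserving_piEquivPiSubtypeProd (fun _ : ι => μ) fun p => σ p = p).integral_comp'
    (fun z : ({p // σ p = p} → X) × ({p // ¬ σ p = p} → X) =>
      (∏ p : {p // σ p = p}, f p (z.1 p, z.1 p)) *
        ∏ p : {p // ¬ σ p = p}, f p (z.2 p, z.2 (movedPerm σ p)))]
  congr 1
  funext x
  exact prod_perm_eq σ f x

theorem integrable_prod_perm (σ : Equiv.Perm ι) {f : ι → X × X → ℂ}
    (hf : ∀ p, Measurable (f p)) (h2 : ∀ p, MemLp (f p) 2 (μ.prod μ))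
    (h1 : ∀ p, σ p = p → Integrable (fun x => f p (x, x)) μ) :
    Integrable (fun x : ι → X => ∏ p, f p (x p, x (σ p))) (Measure.pi fun _ => μ) := by
  have hprod := (Integrable.fintype_prod (μ := fun _ => μ)
    (f := fun (p : {p // σ p = p}) (x : X) => f p (x, x)) fun p => h1 p p.2).mul_prod
    (integrable_prod_pair (movedPerm_ne σ) (f := fun p : {p // ¬ σ p = p} => f p)
      (fun p => hf p) fun p => h2 p)
  refine ((measurePreserving_piEquivPiSubtypeProd (fun _ : ι => μ)
    fun p => σ p = p).integrable_comp_emb (MeasurableEquiv.measurableEmbedding _)).2 hprod |>.congr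
    (Eventually.of_forall fun x => ?_)
  exact (prod_perm_eq σ f x).symm

theorem tendsto_integral_prod_perm (σ : Equiv.Perm ι) {β : Type*} {l : Filter β}
    {u : β → ι → X × X → ℂ} {v : ι → X × X → ℂ}
    (hu : ∀ n p, Measurable (u n p)) (hv : ∀ p, Measurable (v p))
    (hu2 : ∀ n p, MemLp (u n p) 2 (μ.prod μ)) (hv2 : ∀ p, MemLp (v p) 2 (μ.prod μ))
    (h : ∀ p, Tendsto (fun n => eLpNorm (u n p - v p) 2 (μ.prod μ)) l (𝓝 0))
    (h1 : ∀ p, σ p = p →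
      Tendsto (fun n => ∫ x, u n p (x, x) ∂μ) l (𝓝 (∫ x, v p (x, x) ∂μ))) :
    Tendsto (fun n => ∫ x, ∏ p, u n p (x p, x (σ p)) ∂Measure.pi fun _ => μ) l
      (𝓝 (∫ x, ∏ p, v p (x p, x (σ p)) ∂Measure.pi fun _ => μ)) := by
  simp only [integral_prod_perm σ]
  refine Tendsto.mul (tendsto_finsetProd _ fun p _ => h1 p p.2) ?_
  exact tendsto_integral_prod_pair (movedPerm_ne σ) (u := fun n (p : {p // ¬ σ p = p}) => u n p)
    (v := fun p : {p // ¬ σ p = p} => v p) (fun n p => hu n p) (fun p => hv p)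
    (fun n p => hu2 n p) (fun p => hv2 p) fun p => h p

end Cycles

end TreeRep

/-! ### Finite expansions of kernels -/

namespace TreeRep

open Filter Topology

namespace BinaryPartitions

/-- The coefficients of a kernel with respect to a family of functions. -/
noncomputable def kernelCoeff {S J : Type*} [MeasurableSpace S] (lam : Measure S)
    (k : S → S → ℂ) (e : Tree J → S → ℝ) (t s : Tree J) : ℂ :=
  ∫ z : S × S, k z.1 z.2 * (e t z.1 : ℂ) * (e s z.2 : ℂ) ∂(lam.prod lam)

/-- The kernel with finitely many given coefficients. -/
noncomputable def partialKernel {S J : Type*} (e : Tree J → S → ℝ) (κ : Tree J × Tree J → ℂ)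
    (W : Finset (Tree J)) (z : S × S) : ℂ :=
  ∑ q ∈ W ×ˢ W, κ q * ((e q.1 z.1 : ℂ) * (e q.2 z.2 : ℂ))

namespace IsHaarSystem

variable {S J : Type*} [TopologicalSpace S] [MeasurableSpace S] {lam : Measure S}
  {P : BinaryPartitions lam J} {e : Tree J → S → ℝ}

theorem measurable_partialKernel (h : P.IsHaarSystem e) (κ : Tree J × Tree J → ℂ)
    (W : Finset (Tree J)) : Measurable (partialKernel e κ W) :=
  Finset.measurable_sum _ fun q _ => measurable_const.mul
    ((Complex.measurable_ofReal.comp ((h.measurable q.1).comp measurable_fst)).mul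
      (Complex.measurable_ofReal.comp ((h.measurable q.2).comp measurable_snd)))

/-- The coefficients of a kernel cut to the product of two cells. -/
theorem kernelCoeff_indicator (h : P.IsHaarSystem e) [DecidableEq J] (k : S → S → ℂ) (i j : J)
    (t s : Tree J) :
    ∫ z, (e t z.1 : ℂ) * (e s z.2 : ℂ) *
      (P.cell 0 (Label.root i) ×ˢ P.cell 0 (Label.root j)).indicator (fun z => k z.1 z.2) z
        ∂(lam.prod lam) =
      if t.base = i ∧ s.base = j then kernelCoeff lam k e t s else 0 := by
  have hne : ∀ {t : Tree J} {i : J} {x : S}, x ∈ P.cell 0 (Label.root i) → t.base ≠ i →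
      e t x = 0 := fun hx hti =>
    h.eq_zero fun hx' => hti (congrArg Prod.fst (P.cell_eq_of_mem hx' hx))
  split_ifs with hij
  · obtain ⟨rfl, rfl⟩ := hij
    refine integral_congr_ae (Eventually.of_forall fun z => ?_)
    by_cases h1 : z.1 ∈ P.cell 0 (Label.root t.base)
    · by_cases h2 : z.2 ∈ P.cell 0 (Label.root s.base)
      · simp only [indicator_of_mem (show z ∈ P.cell 0 (Label.root t.base) ×ˢ
          P.cell 0 (Label.root s.base) from ⟨h1, h2⟩)]
        ring
      · simp [h.eq_zero h2]
    · simp [h.eq_zero h1]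
  · rw [← integral_zero (S × S) ℂ (μ := lam.prod lam)]
    congr 1
    funext z
    by_cases hz : z ∈ P.cell 0 (Label.root i) ×ˢ P.cell 0 (Label.root j)
    · rcases not_and_or.1 hij with h1 | h1
      · simp [hne hz.1 h1]
      · simp [hne hz.2 h1]
    · simp [hz]

variable [IsFiniteMeasureOnCompacts lam]

theorem integral_partialKernel_diag (h : P.IsHaarSystem e) (κ : Tree J × Tree J → ℂ)
    (W : Finset (Tree J)) :
    ∫ x, partialKernel e κ W (x, x) ∂lam = ∑ t ∈ W, κ (t, t) := by
  classical
  simp only [partialKernel]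
  have hi : ∀ t s, Integrable (fun x => (e t x : ℂ) * (e s x : ℂ)) lam := fun t s =>
    (h.memLp t 2).integrable_mul (h.memLp s 2)
  rw [integral_finsetSum _ fun q _ => (hi q.1 q.2).const_mul (κ q), Finset.sum_product]
  refine Finset.sum_congr rfl fun t ht => ?_
  simp only [integral_const_mul, h.integral_mul_ofReal]
  simp [ht]

variable [SigmaFinite lam]

theorem memLp_partialKernel (h : P.IsHaarSystem e) (κ : Tree J × Tree J → ℂ)
    (W : Finset (Tree J)) : MemLp (partialKernel e κ W) 2 (lam.prod lam) :=
  memLp_finsetSum _ fun q _ => (h.memLp_mul q.1 q.2).const_mul _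

/-- The integral of a product of finite kernels in terms of the coefficients. -/
theorem integral_prod_partialKernel (h : P.IsHaarSystem e) {ι : Type*} [Fintype ι] [DecidableEq ι]
    (σ : Equiv.Perm ι) (κ : ι → Tree J × Tree J → ℂ) (W : Finset (Tree J)) :
    ∫ x, ∏ p, partialKernel e (κ p) W (x p, x (σ p)) ∂(Measure.pi fun _ : ι => lam) =
      ∑ i ∈ Fintype.piFinset fun _ : ι => W, ∏ p, κ p (i p, i (σ p)) := by
  classical
  have hexp : ∀ x : ι → S, ∏ p, partialKernel e (κ p) W (x p, x (σ p)) =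
      ∑ z ∈ Fintype.piFinset fun _ : ι => W ×ˢ W, (∏ p, κ p (z p)) *
        ∏ p, ((e (z p).1 (x p) : ℂ) * (e (z (σ.symm p)).2 (x p) : ℂ)) := by
    intro x
    simp only [partialKernel]
    rw [Finset.prod_univ_sum]
    refine Finset.sum_congr rfl fun z _ => ?_
    rw [Finset.prod_mul_distrib, Finset.prod_mul_distrib, Finset.prod_mul_distrib]
    congr 2
    rw [← Equiv.prod_comp σ fun p => (e (z (σ.symm p)).2 (x p) : ℂ)]
    simp
  simp only [hexp]
  rw [integral_finsetSum]
  swap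
  · intro z _
    exact (Integrable.fintype_prod (μ := fun _ : ι => lam)
      (f := fun p y => (e (z p).1 y : ℂ) * (e (z (σ.symm p)).2 y : ℂ)) fun p =>
      (h.memLp _ 2).integrable_mul (h.memLp _ 2)).const_mul _
  simp only [integral_const_mul]
  have hint : ∀ z : ι → Tree J × Tree J, ∫ x : ι → S,
      ∏ p, ((e (z p).1 (x p) : ℂ) * (e (z (σ.symm p)).2 (x p) : ℂ)) ∂(Measure.pi fun _ => lam) =
      if ∀ p, (z p).1 = (z (σ.symm p)).2 then 1 else 0 := by
    intro z
    rw [integral_fintype_prod_eq_prod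
      (fun p y => (e (z p).1 y : ℂ) * (e (z (σ.symm p)).2 y : ℂ))]
    simp only [h.integral_mul_ofReal]
    exact Fintype.prod_boole
  simp only [hint, mul_ite, mul_one, mul_zero]
  rw [← Finset.sum_filter]
  symm
  -- Orthonormality in each variable forces the second index of factor `p` to equal the first index
  -- of factor `σ p`, so a surviving family of pairs is determined by its first entries.
  refine Finset.sum_nbij (fun i p => (i p, i (σ p))) (fun i hi => ?_) (fun i _ i' _ hii => ?_)
    (fun z hz => ?_) fun i _ => rfl
  · simp only [Fintype.mem_piFinset] at hi
    simp [hi]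
  · funext p
    exact congrArg Prod.fst (congrFun hii p)
  · simp only [Finset.coe_filter, Fintype.mem_piFinset, Finset.mem_product, mem_ofPred_eq] at hz
    refine ⟨fun p => (z p).1, by simpa using fun p => (hz.1 p).1, ?_⟩
    funext p
    refine Prod.ext rfl ?_
    have := hz.2 (σ p)
    rwa [Equiv.symm_apply_apply] at this

variable [BorelSpace S] [Countable J]

theorem tendsto_partialKernel (h : P.IsHaarSystem e) {g : S × S → ℂ}
    (hg : MemLp g 2 (lam.prod lam)) {κ : Tree J × Tree J → ℂ}
    (hκ : ∀ q, κ q = ∫ z, (e q.1 z.1 : ℂ) * (e q.2 z.2 : ℂ) * g z ∂(lam.prod lam)) :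
    Tendsto (fun W => eLpNorm (partialKernel e κ W - g) 2 (lam.prod lam)) atTop (𝓝 0) := by
  have h1 := h.basis₂.hasSum_repr (hg.toLp g)
  have hco : ∀ q, h.basis₂.repr (hg.toLp g) q = κ q := by
    intro q
    rw [HilbertBasis.repr_apply_apply, h.coe_basis₂, h.inner_vec₂, hκ]
    refine integral_congr_ae ?_
    filter_upwards [hg.coeFn_toLp] with z hz
    rw [hz]
  simp only [hco, h.coe_basis₂] at h1
  -- Squares are cofinal among the finite sets of pairs, so the basis expansion converges along
  -- them.
  have hW : Tendsto (fun W : Finset (Tree J) => W ×ˢ W) atTop atTop := by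
    classical
    refine tendsto_atTop_finset_of_monotone
      (fun W W' hWW => Finset.product_subset_product hWW hWW) fun q => ⟨{q.1, q.2}, by simp⟩
  have h2 := h1.comp hW
  rw [tendsto_iff_edist_tendsto_0] at h2
  refine h2.congr fun W => ?_
  rw [edist_eq_enorm_sub, Lp.enorm_def]
  refine eLpNorm_congr_ae ?_
  refine (Lp.coeFn_sub _ _).trans ?_
  refine EventuallyEq.sub ?_ hg.coeFn_toLp
  have h3 : (fun z => ∑ q ∈ W ×ˢ W, (κ q • h.vec₂ q) z) =ᵐ[lam.prod lam] partialKernel e κ W := by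
    have h4 : ∀ q : Tree J × Tree J, ∀ᵐ z ∂(lam.prod lam), (κ q • h.vec₂ q) z =
        κ q * ((e q.1 z.1 : ℂ) * (e q.2 z.2 : ℂ)) := by
      intro q
      filter_upwards [Lp.coeFn_smul (κ q) (h.vec₂ q), h.coeFn_vec₂ q] with z hz hz'
      rw [hz, Pi.smul_apply, hz', smul_eq_mul]
    filter_upwards [ae_all_iff.2 h4] with z hz
    exact Finset.sum_congr rfl fun q _ => hz q
  refine EventuallyEq.trans ?_ h3
  exact Lp.coeFn_fun_finsetSum (W ×ˢ W) fun q => κ q • h.vec₂ q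

/-- The trace of the kernel on a cell in terms of the coefficients. -/
theorem hasSum_kernelCoeff_diag (h : P.IsHaarSystem e) {k : S → S → ℂ} {j : J}
    (hk2 : MemLp ((P.cell 0 (Label.root j) ×ˢ P.cell 0 (Label.root j)).indicator
      fun z => k z.1 z.2) 2 (lam.prod lam))
    {T : Lp ℂ 2 lam →L[ℂ] Lp ℂ 2 lam}
    (hT : IsIntegralOperator lam (cutKernel (P.cell 0 (Label.root j)) k) T) {c : ℂ}
    (htr : HasTrace T c) :
    HasSum (fun t => ∫ z, (e t z.1 : ℂ) * (e t z.2 : ℂ) *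
      (P.cell 0 (Label.root j) ×ˢ P.cell 0 (Label.root j)).indicator (fun z => k z.1 z.2) z
        ∂(lam.prod lam)) c := by
  have h1 := htr.hasSum_inner h.basis
  convert h1 using 2 with t
  rw [h.coe_basis, h.inner_vec, integral_prod _ (h.integrable_mul_mul hk2 t t)]
  refine integral_congr_ae ?_
  filter_upwards [hT (h.vec t)] with x hx
  rw [hx.2, ← integral_const_mul]
  refine integral_congr_ae ?_
  filter_upwards [h.coeFn_vec t] with y hy
  rw [hy, cutKernel]
  ring

end IsHaarSystem

end BinaryPartitions

end TreeRep

/-! ### Passage to the limit in the `α`-determinant -/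

namespace TreeRep

open Filter Topology

namespace BinaryPartitions

section Limit

variable {S J : Type*} [TopologicalSpace S] [MeasurableSpace S] {lam : Measure S}

/-- Every variable is the first argument of one factor, so cutting the factors one by one amounts to
cutting to the whole box. -/
theorem prod_indicator_kernel (P : BinaryPartitions lam J) (k : S → S → ℂ) {m : ℕ}
    (a : Fin m → J) (σ : Equiv.Perm (Fin m)) (x : Fin m → S) :
    ∏ p, (P.cell 0 (Label.root (a p)) ×ˢ P.cell 0 (Label.root (a (σ p)))).indicator
      (fun z => k z.1 z.2) (x p, x (σ p)) =
      {x : Fin m → S | ∀ p, x p ∈ P.cell 0 (Label.root (a p))}.indicator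
        (fun x => ∏ p, k (x p) (x (σ p))) x := by
  by_cases hx : x ∈ {x : Fin m → S | ∀ p, x p ∈ P.cell 0 (Label.root (a p))}
  · rw [indicator_of_mem hx]
    exact Finset.prod_congr rfl fun p _ => indicator_of_mem (s := _ ×ˢ _) ⟨hx p, hx (σ p)⟩ _
  · rw [indicator_of_notMem hx]
    simp only [mem_ofPred_eq, not_forall] at hx
    obtain ⟨p, hp⟩ := hx
    exact Finset.prod_eq_zero (Finset.mem_univ p) (indicator_of_notMem (fun h => hp h.1) _)

theorem measurableSet_box (P : BinaryPartitions lam J) {m n : ℕ} (a : Fin m → Label J n) :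
    MeasurableSet {x : Fin m → S | ∀ p, x p ∈ P.cell n (a p)} := by
  rw [ofPred_forall]
  exact MeasurableSet.iInter fun p => measurable_pi_apply p (P.measurableSet_cell _ _)

variable [BorelSpace S] [IsFiniteMeasureOnCompacts lam] [SigmaFinite lam] [Countable J]
  {P : BinaryPartitions lam J} {e : Tree J → S → ℝ}

theorem IsHaarSystem.memLp_indicator_kernel (h : P.IsHaarSystem e) {α : ℝ} {k : S → S → ℂ}
    (hk : AdmissibleKernel lam α k) (i j : J) :
    MemLp ((P.cell 0 (Label.root i) ×ˢ P.cell 0 (Label.root j)).indicator fun z => k z.1 z.2) 2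
      (lam.prod lam) := by
  obtain ⟨T, hT, htr⟩ := hk.locallyTraceClass _
    ((P.isCompact_closure 0 (Label.root i)).union (P.isCompact_closure 0 (Label.root j)))
  have hs := htr.summable_norm_sq h.basis
  rw [h.coe_basis] at hs
  exact h.memLp_kernel hk.measurable hT hs (subset_closure.trans subset_union_left)
    (subset_closure.trans subset_union_right)

/-- The integral of the `α`-determinant over a product of cells is the limit of the sums of the
`α`-determinants of the coefficients over finite sets of nodes. -/
theorem IsHaarSystem.tendsto_sum_alphaDet (h : P.IsHaarSystem e) {α : ℝ} {k : S → S → ℂ}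
    (hk : AdmissibleKernel lam α k) {m : ℕ} (a : Fin m → J) [DecidableEq J] :
    IntegrableOn (fun x : Fin m → S => alphaDet α (Matrix.of fun p q => k (x p) (x q)))
      {x | ∀ p, x p ∈ P.cell 0 (Label.root (a p))} (Measure.pi fun _ => lam) ∧
    Tendsto (fun W => ∑ i ∈ Fintype.piFinset fun _ : Fin m => W, if ∀ p, (i p).base = a p then
        alphaDet α (Matrix.of fun p q => kernelCoeff lam k e (i p) (i q)) else 0) atTop
      (𝓝 (∫ x in {x : Fin m → S | ∀ p, x p ∈ P.cell 0 (Label.root (a p))},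
        alphaDet α (Matrix.of fun p q => k (x p) (x q)) ∂(Measure.pi fun _ => lam))) := by
  set B := {x : Fin m → S | ∀ p, x p ∈ P.cell 0 (Label.root (a p))} with hB
  have hBm : MeasurableSet B := P.measurableSet_box fun p => Label.root (a p)
  set v : Equiv.Perm (Fin m) → Fin m → S × S → ℂ := fun σ p =>
    (P.cell 0 (Label.root (a p)) ×ˢ P.cell 0 (Label.root (a (σ p)))).indicator
      fun z => k z.1 z.2 with hv
  -- These are the coefficients of the cut kernel `v σ p`: the cut annihilates all pairs of nodes
  -- outside the trees of `a p` and `a (σ p)`.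
  set κ : Equiv.Perm (Fin m) → Fin m → Tree J × Tree J → ℂ := fun σ p q =>
    if q.1.base = a p ∧ q.2.base = a (σ p) then kernelCoeff lam k e q.1 q.2 else 0 with hκ
  have hvm : ∀ σ p, Measurable (v σ p) := fun σ p =>
    hk.measurable.indicator ((P.measurableSet_cell _ _).prod (P.measurableSet_cell _ _))
  have hv2 : ∀ σ p, MemLp (v σ p) 2 (lam.prod lam) := fun σ p => h.memLp_indicator_kernel hk _ _
  have hdiag : ∀ σ p, σ p = p → (fun x => v σ p (x, x)) =
      (P.cell 0 (Label.root (a p))).indicator fun x => k x x := by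
    intro σ p hp
    funext x
    simp only [hv, hp]
    by_cases hx : x ∈ P.cell 0 (Label.root (a p)) <;> simp [hx]
  have hint : ∀ σ, Integrable (fun x : Fin m → S => ∏ p, v σ p (x p, x (σ p)))
      (Measure.pi fun _ => lam) := fun σ =>
    integrable_prod_perm σ (hvm σ) (hv2 σ) fun p hp => by
      rw [hdiag σ p hp, integrable_indicator_iff (P.measurableSet_cell _ _)]
      exact (hk.trace_eq _ (P.measurableSet_cell _ _) (P.isCompact_closure _ _)).1
  have hsum : ∀ x, B.indicator (fun x : Fin m → S =>
      alphaDet α (Matrix.of fun p q => k (x p) (x q))) x =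
      ∑ σ : Equiv.Perm (Fin m), (α : ℂ) ^ (m - numCycles σ) * ∏ p, v σ p (x p, x (σ p)) := by
    intro x
    have h1 : ∀ σ : Equiv.Perm (Fin m), ∏ p, v σ p (x p, x (σ p)) = _ := fun σ =>
      P.prod_indicator_kernel k a σ x
    simp only [h1]
    by_cases hx : x ∈ B
    · simp only [← hB, indicator_of_mem hx]
      rfl
    · simp only [← hB, indicator_of_notMem hx, mul_zero, Finset.sum_const_zero]
  refine ⟨?_, ?_⟩
  · rw [← integrable_indicator_iff hBm]
    have h2 := integrable_finsetSum Finset.univ fun (σ : Equiv.Perm (Fin m)) _ =>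
      (hint σ).const_mul ((α : ℂ) ^ (m - numCycles σ))
    exact h2.congr (Eventually.of_forall fun x => (hsum x).symm)
  · rw [← integral_indicator hBm]
    simp only [hsum]
    rw [integral_finsetSum _ fun σ _ => (hint σ).const_mul _]
    simp only [integral_const_mul]
    have hfin : ∀ W : Finset (Tree J), ∑ i ∈ Fintype.piFinset (fun _ : Fin m => W),
        (if ∀ p, (i p).base = a p then
          alphaDet α (Matrix.of fun p q => kernelCoeff lam k e (i p) (i q)) else 0) =
        ∑ σ : Equiv.Perm (Fin m), (α : ℂ) ^ (m - numCycles σ) *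
          ∫ x, ∏ p, partialKernel e (κ σ p) W (x p, x (σ p)) ∂(Measure.pi fun _ => lam) := by
      intro W
      simp only [h.integral_prod_partialKernel, Finset.mul_sum]
      rw [Finset.sum_comm]
      refine Finset.sum_congr rfl fun i _ => ?_
      split_ifs with hi
      · refine Finset.sum_congr rfl fun σ _ => ?_
        congr 1
        exact Finset.prod_congr rfl fun p _ => (if_pos ⟨hi p, hi (σ p)⟩).symm
      · obtain ⟨p, hp⟩ := not_forall.1 hi
        refine (Finset.sum_eq_zero fun σ _ => ?_).symm
        rw [Finset.prod_eq_zero (Finset.mem_univ p) (if_neg fun h => hp h.1), mul_zero]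
    simp only [hfin]
    refine tendsto_finsetSum _ fun σ _ => Tendsto.const_mul _ ?_
    have hco : ∀ p q, κ σ p q = ∫ z, (e q.1 z.1 : ℂ) * (e q.2 z.2 : ℂ) * v σ p z
        ∂(lam.prod lam) := fun p q => (h.kernelCoeff_indicator k _ _ _ _).symm
    refine tendsto_integral_prod_perm σ (u := fun W p => partialKernel e (κ σ p) W)
      (fun W p => h.measurable_partialKernel _ _) (hvm σ)
      (fun W p => h.memLp_partialKernel _ _) (hv2 σ)
      (fun p => h.tendsto_partialKernel (hv2 σ p) (hco p)) fun p hp => ?_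
    -- At a fixed point the partial sums of the diagonal coefficients must tend to the integral of
    -- the actual diagonal `k x x`; this is where the version of the kernel matters.
    simp only [h.integral_partialKernel_diag]
    obtain ⟨-, T, hT, htr⟩ := hk.trace_eq _ (P.measurableSet_cell 0 (Label.root (a p)))
      (P.isCompact_closure 0 (Label.root (a p)))
    rw [hdiag σ p hp, integral_indicator (P.measurableSet_cell _ _)]
    have h3 := h.hasSum_kernelCoeff_diag (h.memLp_indicator_kernel hk _ _) hT htr
    have h4 : ∀ t, κ σ p (t, t) = _ := fun t => hco p (t, t)
    simp only [h4]
    simp only [hv, hp]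
    exact h3

end Limit

end BinaryPartitions

/-! ### Counting points -/

/-- A sum of Dirac masses evaluated on a measurable set is the cardinality of an index set. -/
theorem Conf.exists_count_eq {S : Type*} [TopologicalSpace S] [MeasurableSpace S] (s : Conf S)
    {A : Set S} (hA : MeasurableSet A) : ∃ r : ℕ∞, s.count A = r := by
  obtain ⟨⟨N, x, hx⟩, -⟩ := s.2
  refine ⟨(x ⁻¹' A).encard, ?_⟩
  rw [Conf.count, hx, Measure.sum_apply _ hA, ← ENNReal.tsum_set_one,
    tsum_subtype (x ⁻¹' A) fun _ => (1 : ℝ≥0∞)]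
  refine tsum_congr fun i => ?_
  rw [Measure.dirac_apply' _ hA]
  rfl

namespace BinaryPartitions

/-- Counts take countably many values, and the event that a count is infinite is the complement of
the generating events with natural values. -/
theorem measurable_count {S J : Type*} [TopologicalSpace S] [MeasurableSpace S] {lam : Measure S}
    (P : BinaryPartitions lam J) (n : ℕ) (i : Label J n) :
    Measurable[P.countField n] fun s : Conf S => s.count (P.cell n i) := by
  let _ : MeasurableSpace (Conf S) := P.countField n
  have hr : ∀ r : ℕ, MeasurableSet {s : Conf S | s.count (P.cell n i) = r} := fun r =>
    MeasurableSpace.measurableSet_generateFrom ⟨i, r, rfl⟩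
  have htop : MeasurableSet {s : Conf S | s.count (P.cell n i) = ∞} := by
    have : {s : Conf S | s.count (P.cell n i) = ∞} =
        (⋃ r : ℕ, {s : Conf S | s.count (P.cell n i) = r})ᶜ := by
      ext s
      obtain ⟨r, h⟩ := s.exists_count_eq (P.measurableSet_cell n i)
      simp only [mem_ofPred_eq, mem_compl_iff, mem_iUnion, h]
      induction r using ENat.recTopCoe with
      | top => simp
      | coe r => simp
    rw [this]
    exact (MeasurableSet.iUnion hr).compl
  intro B _
  have : (fun s : Conf S => s.count (P.cell n i)) ⁻¹' B =
      ⋃ r ∈ {r : ℕ∞ | (r : ℝ≥0∞) ∈ B}, {s : Conf S | s.count (P.cell n i) = r} := by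
    ext s
    obtain ⟨r, h⟩ := s.exists_count_eq (P.measurableSet_cell n i)
    simp [h]
  rw [this]
  refine MeasurableSet.biUnion (to_countable _) fun r _ => ?_
  induction r using ENat.recTopCoe with
  | top => simpa using htop
  | coe r => simpa using hr r

end BinaryPartitions

/-- A finite family factors through a family without repetitions. -/
theorem exists_injective_factor {X : Type*} {m : ℕ} (a : Fin m → X) :
    ∃ (j : ℕ) (c : Fin m → Fin j) (b : Fin j → X), Function.Injective b ∧ ∀ p, b (c p) = a p := by
  classical
  let E := (Finset.univ.image a).equivFin
  refine ⟨_, fun p => E ⟨a p, Finset.mem_image_of_mem a (Finset.mem_univ p)⟩,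
    fun q => (E.symm q : X), fun q q' h => ?_, fun p => by simp⟩
  exact E.symm.injective (Subtype.ext h)

/-- The correlation function of the restriction to a count σ-field has the same integrals over
products of cells. -/
theorem IsCorrelationFunction.lintegral_box_eq {S J : Type*} [TopologicalSpace S]
    [MeasurableSpace S] {lam : Measure S} (P : BinaryPartitions lam J) (n : ℕ)
    {μ : Measure (Conf S)} {m : ℕ} {ρ ρ' : (Fin m → S) → ℝ≥0}
    (hρ : IsCorrelationFunction (μ.trim (P.countField_le n)) lam (P.sigmaField n) m ρ)
    (hρ' : IsCorrelationFunction μ lam inferInstance m ρ') (a : Fin m → Label J n) :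
    ∫⁻ x in {x : Fin m → S | ∀ p, x p ∈ P.cell n (a p)}, (ρ x : ℝ≥0∞)
        ∂(Measure.pi fun _ => lam) =
      ∫⁻ x in {x : Fin m → S | ∀ p, x p ∈ P.cell n (a p)}, (ρ' x : ℝ≥0∞)
        ∂(Measure.pi fun _ => lam) := by
  -- The moment identity requires disjoint sets; repeated cells are turned into multiplicities of
  -- `c`.
  obtain ⟨j, c, b, hb, hcb⟩ := exists_injective_factor a
  have hd : Pairwise fun i i' => Disjoint (P.cell n (b i)) (P.cell n (b i')) := fun i i' h =>
    P.pairwise_disjoint n (hb.ne h)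
  have h1 := hρ.moment j (fun i => P.cell n (b i)) c
    (fun i => MeasurableSpace.measurableSet_generateFrom ⟨_, rfl⟩) hd
  have h2 := hρ'.moment j (fun i => P.cell n (b i)) c (fun i => P.measurableSet_cell _ _) hd
  unfold MomentIdentity at h1 h2
  simp only [hcb] at h1 h2
  rw [← h1, ← h2]
  refine lintegral_trim (P.countField_le n) ?_
  let _ : MeasurableSpace (Conf S) := P.countField n
  refine Finset.measurable_prod _ fun i _ => Finset.measurable_prod _ fun t _ => ?_
  exact (P.measurable_count n (b i)).sub_const _

/-- On a countable discrete set the correlation function is unique. -/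
theorem IsCorrelationFunction.eq_of_count {X : Type*} [TopologicalSpace X] [MeasurableSpace X]
    [MeasurableSingletonClass X] [Countable X] {ν : Measure (Conf X)} {m : ℕ}
    {ρ ρ' : (Fin m → X) → ℝ≥0}
    (hρ : IsCorrelationFunction ν Measure.count inferInstance m ρ)
    (hρ' : IsCorrelationFunction ν Measure.count inferInstance m ρ') (i : Fin m → X) :
    ρ i = ρ' i := by
  obtain ⟨j, c, b, hb, hcb⟩ := exists_injective_factor i
  have hd : Pairwise fun i i' => Disjoint ({b i} : Set X) {b i'} := fun i i' h => by
    simpa using hb.ne h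
  have h1 := hρ.moment j (fun i => {b i}) c (fun i => measurableSet_singleton _) hd
  have h2 := hρ'.moment j (fun i => {b i}) c (fun i => measurableSet_singleton _) hd
  unfold MomentIdentity at h1 h2
  -- The box is a single tuple of mass one, so the moment identity determines the value there.
  have hset : {x : Fin m → X | ∀ p, x p ∈ ({b (c p)} : Set X)} = {i} := by
    ext x
    simp only [mem_ofPred_eq, mem_singleton_iff, hcb, funext_iff]
  have hone : (Measure.pi fun _ : Fin m => (Measure.count : Measure X)) {i} = 1 := by
    simp [Measure.pi_singleton]
  rw [h1, hset, Measure.restrict_singleton, hone, one_smul, lintegral_dirac, lintegral_dirac] at h2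
  exact_mod_cast h2

end TreeRep

/-! ### Comparison of the correlation functions -/

namespace TreeRep

open Filter Topology

/-- The integral over a product of cells of the correlation function at a level is the sum of the
correlation function of the process on the tree over the nodes below these cells. -/
theorem lintegral_box_eq_tsum {S : Type*} [TopologicalSpace S]
    [MeasurableSpace S] [BorelSpace S]
    (lam : Measure S) [IsFiniteMeasureOnCompacts lam] [SigmaFinite lam]
    (α : ℝ) (k : S → S → ℂ) (hk : AdmissibleKernel lam α k)
    (μ : Measure (Conf S))
    (hμ : IsAlphaDeterminantal α k lam μ)
    {I : Type*} [Countable I] (P : BinaryPartitions lam I)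
    (f : TreeRep.Tree I → S → ℝ) (hf : P.IsTreeBasis f)
    (n : ℕ)
    (ν : Measure (Conf (TreeRep.Tree (Label I n))))
    (hν : IsAlphaDeterminantal α (P.levelKernel k f n) Measure.count ν)
    (m : ℕ)
    (ρ : (Fin m → S) → ℝ≥0)
    (hρ : IsCorrelationFunction (μ.trim (P.countField_le n)) lam (P.sigmaField n) m ρ)
    (ρF : (Fin m → TreeRep.Tree (Label I n)) → ℝ≥0)
    (hρF : IsCorrelationFunction ν Measure.count inferInstance m ρF)
    (a : Fin m → Label I n) :
    ∫⁻ x in {x : Fin m → S | ∀ p, x p ∈ P.cell n (a p)}, (ρ x : ℝ≥0∞)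
        ∂(Measure.pi fun _ => lam) ≠ ∞ ∧
    ∫⁻ x in {x : Fin m → S | ∀ p, x p ∈ P.cell n (a p)}, (ρ x : ℝ≥0∞)
        ∂(Measure.pi fun _ => lam) =
      ∑' i : P.treeBox n (fun p => P.cell n (a p)), (ρF i.1 : ℝ≥0∞) := by
  classical
  have h : (P.shift n).IsHaarSystem (P.levelFun f n) := hf.isHaarSystem.levelFun n
  obtain ⟨ρμ, hρμ, hρμ'⟩ := hμ.correlation m
  obtain ⟨ρν, hρν, hρν'⟩ := hν.correlation m
  obtain ⟨hint, hlim⟩ := h.tendsto_sum_alphaDet hk a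
  simp only [P.shift_cell_root] at hint hlim
  have hρF' : ∀ i, ((ρF i : ℝ) : ℂ) =
      alphaDet α (Matrix.of fun p q => P.levelKernel k f n (i p) (i q)) := by
    intro i
    rw [hρF.eq_of_count hρν i]
    -- Every tuple has positive mass for the product of counting measures, so the almost everywhere
    -- identity holds at every tuple.
    refine ae_iff_of_countable.1 hρν' i ?_
    simp [Measure.pi_singleton]
  rw [IsCorrelationFunction.lintegral_box_eq P n hρ hρμ a]
  set B := {x : Fin m → S | ∀ p, x p ∈ P.cell n (a p)} with hB
  set π := Measure.pi fun _ : Fin m => lam with hπ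
  have hae : (fun x => alphaDet α (Matrix.of fun p q => k (x p) (x q))) =ᵐ[π.restrict B]
      fun x => ((ρμ x : ℝ) : ℂ) :=
    ae_restrict_of_ae (hρμ'.mono fun x hx => hx.symm)
  have hre : Integrable (fun x => (ρμ x : ℝ)) (π.restrict B) := by
    simpa using (hint.congr hae).re
  have hL : ∫⁻ x in B, (ρμ x : ℝ≥0∞) ∂π = ENNReal.ofReal (∫ x in B, (ρμ x : ℝ) ∂π) := by
    rw [ofReal_integral_eq_lintegral_ofReal hre (Eventually.of_forall fun x => (ρμ x).2)]
    simp only [ENNReal.ofReal_coe_nnreal]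
  rw [hL]
  refine ⟨ENNReal.ofReal_ne_top, ?_⟩
  have hlim' : Tendsto (fun W => ∑ i ∈ Fintype.piFinset fun _ : Fin m => W,
      (P.treeBox n (fun p => P.cell n (a p))).indicator (fun i => (ρF i : ℝ)) i) atTop
      (𝓝 (∫ x in B, (ρμ x : ℝ) ∂π)) := by
    rw [integral_congr_ae hae, integral_complex_ofReal] at hlim
    have h1 := (Complex.continuous_re.tendsto _).comp hlim
    rw [Complex.ofReal_re] at h1
    refine h1.congr fun W => ?_
    rw [Function.comp_apply, Complex.re_sum]
    refine Finset.sum_congr rfl fun i _ => ?_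
    by_cases hi : ∀ p, (i p).base = a p
    · have hi' : i ∈ P.treeBox n (fun p => P.cell n (a p)) := (P.mem_treeBox_iff n a i).2 hi
      rw [if_pos hi, indicator_of_mem hi', ← Complex.ofReal_re (ρF i : ℝ), hρF']
      rfl
    · have hi' : i ∉ P.treeBox n (fun p => P.cell n (a p)) := fun h =>
        hi ((P.mem_treeBox_iff n a i).1 h)
      rw [if_neg hi, indicator_of_notMem hi', Complex.zero_re]
  have hW : Tendsto (fun W : Finset (TreeRep.Tree (Label I n)) => Fintype.piFinset fun _ : Fin m => W)
      atTop atTop :=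
    tendsto_atTop_finset_of_monotone (fun W W' hWW => Fintype.piFinset_subset _ _ fun _ => hWW)
      fun i => ⟨Finset.univ.image i, by simp⟩
  -- In `ℝ≥0∞` every family is summable, so the sums over the cofinal boxes `W ^ m` tend to the full
  -- sum; they have the other integral as limit too.
  have hlim'' := (ENNReal.summable (f := (P.treeBox n (fun p => P.cell n (a p))).indicator
    fun i => (ρF i : ℝ≥0∞))).hasSum.comp hW
  rw [tsum_subtype (P.treeBox n (fun p => P.cell n (a p))) fun i => (ρF i : ℝ≥0∞)]
  refine tendsto_nhds_unique (ENNReal.tendsto_ofReal hlim') (hlim''.congr fun W => ?_)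
  have hnn : ∀ i, 0 ≤ (P.treeBox n (fun p => P.cell n (a p))).indicator (fun i => (ρF i : ℝ)) i :=
    fun i => indicator_nonneg (fun i _ => (ρF i).2) i
  rw [Function.comp_apply, ENNReal.ofReal_sum_of_nonneg fun i _ => hnn i]
  refine Finset.sum_congr rfl fun i _ => ?_
  by_cases hi : i ∈ P.treeBox n (fun p => P.cell n (a p)) <;> simp [hi]

end TreeRep

/-- Parseval-type identity between the correlation functions of `μ` restricted to the count σ-field
of level `ℓ = n + 1` and those of the `α`-determinantal process on the tree index set `𝕀(ℓ)`. -/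
theorem theorem2p1 {S : Type*} [TopologicalSpace S] [T2Space S] [LocallyCompactSpace S]
    [SecondCountableTopology S] [MeasurableSpace S] [BorelSpace S]
    (lam : MeasureTheory.Measure S) [lam.Regular] [lam.IsOpenPosMeasure]
    (α : ℝ) (k : S → S → ℂ) (hk : TreeRep.AdmissibleKernel lam α k)
    (μ : MeasureTheory.Measure (TreeRep.Conf S))
    (hμ : TreeRep.IsAlphaDeterminantal α k lam μ)
    {I : Type*} [Countable I] (P : TreeRep.BinaryPartitions lam I)
    (f : TreeRep.Tree I → S → ℝ) (hf : P.IsTreeBasis f)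
    (n : ℕ)
    (ν : MeasureTheory.Measure (TreeRep.Conf (TreeRep.Tree (TreeRep.Label I n))))
    (hν : TreeRep.IsAlphaDeterminantal α (P.levelKernel k f n) MeasureTheory.Measure.count ν)
    (m : ℕ)
    (ρ : (Fin m → S) → ℝ≥0)
    (hρ : TreeRep.IsCorrelationFunction (μ.trim (P.countField_le n)) lam (P.sigmaField n) m ρ)
    (ρF : (Fin m → TreeRep.Tree (TreeRep.Label I n)) → ℝ≥0)
    (hρF : TreeRep.IsCorrelationFunction ν MeasureTheory.Measure.count inferInstance m ρF)
    (a : Fin m → TreeRep.Label I n) :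
    ∫⁻ x in {x : Fin m → S | ∀ p, x p ∈ P.cell n (a p)}, (ρ x : ℝ≥0∞)
        ∂(MeasureTheory.Measure.pi fun _ => lam) ≠ ∞ ∧
    ∫⁻ x in {x : Fin m → S | ∀ p, x p ∈ P.cell n (a p)}, (ρ x : ℝ≥0∞)
        ∂(MeasureTheory.Measure.pi fun _ => lam) =
      ∑' i : P.treeBox n (fun p => P.cell n (a p)), (ρF i.1 : ℝ≥0∞) :=
  TreeRep.lintegral_box_eq_tsum lam α k hk μ hμ P f hf n ν hν m ρ hρ ρF hρF a
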